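/- **Setting.** Let $R=\mathrm{Hom}(\mathbb Q/\mathbb Z,\mathbb Q/\mathbb Z)=\hat{\mathbb Z}$, $\Gamma=\mathrm{SL}_2(\mathbb Z)$, and let $M_2(\mathbb Z)^+$ be the set of integral $2\times2$ matrices of positive determinant. For $\rho\in M_2(R)$, $\tau\in\mathbb H$ and $a\in(\mathbb Q/\mathbb Z)^2$ put $\Lambda=\mathbb Z+\tau\mathbb Z$, $\rho_j(a)=\sum_k\rho_{jk}(a_k)$ and $\phi(a)=\rho_1(a)-\tau\rho_2(a)\in\mathbb Q\Lambda/\Lambda$. Let $X_a(\rho,\tau)=\pi^{-2}\wp_\Lambda(\phi(a))$ if $\phi(a)\neq0$, and $X_a(\rho,\tau)=0$ if $\phi(a)=0$. For a lattice $L=m(\mathbb Z^2)\subset\mathbb Z^2$, $m\in M_2(\mathbb Z)^+$, let $\pi_L$ be the characteristic function of $mM_2(R)\subset M_2(R)$. For $N\ge1$ let $S_N$ be the finite set of lattices $L$ with $N\mathbb Z^2\subset L\subset\mathbb Z^2$, and for $L\in S_N$ let $$\pi(N,L)=\pi_L\prod_{L'\in S_N,\;L'\subsetneq L}(1-\pi_{L'}).$$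 For $\gamma=\begin{pmatrix}a&b\\c&d\end{pmatrix}\in\mathrm{GL}_2^+(\mathbb Q)$ let $(\Delta|\gamma)(\tau)=\det(\gamma)^6\,\Delta(\gamma\tau)\,(c\tau+d)^{-12}$ and $$\mu_\gamma(\tau)=\frac1{6\pi i}\,\frac{d}{d\tau}\log\frac{\Delta|\gamma}{\Delta}(\tau),\qquad \mu_L:=\mu_{m^{-1}}\ \text{ for } m\in M_2(\mathbb Z)^+,\ m(\mathbb Z^2)=L.$$ **Proposition.** Let $N\ge1$. There are modular forms $\omega_{N,L,k}$ ($L\in S_N$, $k\ge0$) of level $N$ (that is, for $\Gamma(N)$, holomorphic on $\mathbb H$ and at all cusps) and weight $2k$ such that for all $k\ge0$ and all $(\rho,\tau)\in M_2(R)\times\mathbb H$ $$\sum_{a\in(\mathbb Q/\mathbb Z)^2,\;Na=0}X_a(\rho,\tau)^k=\sum_{L\in S_N}\pi(N,L)(\rho)\,\omega_{N,L,k}(\tau)\qquad(\text{with }X_a^0=1).$$ They are canonical: for each $k$ they are the only functions $S_N\times\mathbb H\to\mathbb C$ that satisfy this relation for all $(\rho,\tau)$, and for all $\gamma=\begin{pmatrix}a&b\\c&d\end{pmatrix}\in\Gamma$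 $$\omega_{N,L,k}(\gamma\tau)=(c\tau+d)^{2k}\,\omega_{N,\gamma^{-1}L,k}(\tau).$$ Every $L\in S_N$ is of the form $m(\mathbb Z^2)$ with $m\in M_2(\mathbb Z)^+$, $\mu_L$ does not depend on the choice of $m$, and for $k=1$ one has $\omega_{N,L,1}=N^2\mu_L$, so that $$\sum_{Na=0}X_a(\rho,\tau)=N^2\sum_{L\in S_N}\pi(N,L)(\rho)\,\mu_L(\tau).$$ -/

import Mathlib

open scoped MatrixGroups

noncomputable section

namespace DivisionRelations

/-! ### The ring `R = Hom(ℚ/ℤ, ℚ/ℤ)`, the matrices `M₂(R)` and lattices in `ℤ²` -/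

/-- The group `ℚ/ℤ`. -/
abbrev QmodZ : Type := AddCircle (1 : ℚ)

/-- The ring `R = Hom(ℚ/ℤ, ℚ/ℤ)` (the profinite integers); its product is composition. -/
abbrev R : Type := AddMonoid.End QmodZ

/-- `M₂(R)`. -/
abbrev M2R : Type := Matrix (Fin 2) (Fin 2) R

/-- `M₂(ℤ)⁺`, the integral matrices of positive determinant. -/
abbrev M2ZPos : Type := {m : Matrix (Fin 2) (Fin 2) ℤ // 0 < m.det}

/-- The action of `M₂(R)` on `(ℚ/ℤ)²`: `ρ_j(a) = ∑_k ρ_{jk}(a_k)`. -/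
def act (ρ : M2R) (a : Fin 2 → QmodZ) : Fin 2 → QmodZ :=
  fun j => ∑ k, ρ j k (a k)

/-- Subgroups of `ℤ²`. -/
abbrev SubZ2 : Type := Submodule ℤ (Fin 2 → ℤ)

/-- The lattice `m(ℤ²)`. -/
def latticeOf (m : Matrix (Fin 2) (Fin 2) ℤ) : SubZ2 :=
  LinearMap.range m.mulVecLin

/-- The image `g(L)` of a lattice `L` under `g ∈ SL₂(ℤ)`. -/
def smulLattice (g : SL(2, ℤ)) (L : SubZ2) : SubZ2 :=
  L.map (g : Matrix (Fin 2) (Fin 2) ℤ).mulVecLin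

/-- The image of an integral matrix in `M₂(R)`. -/
def toM2R (m : Matrix (Fin 2) (Fin 2) ℤ) : M2R :=
  m.map (fun n : ℤ => (n : R))

/-- `N ℤ²`. -/
def NZ2 (N : ℕ) : SubZ2 := LinearMap.range ((N : ℤ) • LinearMap.id : (Fin 2 → ℤ) →ₗ[ℤ] (Fin 2 → ℤ))

lemma finite_lattices (N : ℕ) [NeZero N] : {L : SubZ2 | NZ2 N ≤ L}.Finite := by
  let f : (Fin 2 → ℤ) →+ (Fin 2 → ZMod N) :=
    AddMonoidHom.compLeft (Int.castAddHom (ZMod N)) (Fin 2)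
  refine Set.Finite.of_injOn (f := fun L : SubZ2 => L.toAddSubgroup.map f)
    (t := Set.univ) (fun _ _ => Set.mem_univ _) ?_ Set.finite_univ
  have key : ∀ L : SubZ2, NZ2 N ≤ L → (L.toAddSubgroup.map f).comap f = L.toAddSubgroup := by
    intro L hL
    rw [AddSubgroup.comap_map_eq, sup_eq_left]
    intro x hx
    apply hL
    have h : ∀ i, (N : ℤ) ∣ x i := fun i =>
      (ZMod.intCast_zmod_eq_zero_iff_dvd _ _).1 (congrFun (AddMonoidHom.mem_ker.1 hx) i)
    choose y hy using h
    exact ⟨y, by ext i; simp [hy i]⟩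
  intro L hL L' hL' h
  apply Submodule.toAddSubgroup_injective
  rw [← key L hL, ← key L' hL']
  exact congrArg (AddSubgroup.comap f) h

/-- `S_N`, the set of lattices `L` with `N ℤ² ⊆ L ⊆ ℤ²`. -/
def S (N : ℕ) [NeZero N] : Finset SubZ2 := (finite_lattices N).toFinset

open Classical in
/-- `π_L`, the characteristic function of `m M₂(R)`, where `m ∈ M₂(ℤ)⁺` and `m(ℤ²) = L`. -/
def piL (L : SubZ2) (ρ : M2R) : ℂ :=
  if ∃ m : M2ZPos, latticeOf m.1 = L ∧ ∃ ν : M2R, ρ = toM2R m.1 * ν then 1 else 0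

open Classical in
/-- `π(N, L) = π_L ∏_{L' ∈ S_N, L' ⊊ L} (1 - π_{L'})`. -/
def piNL (N : ℕ) [NeZero N] (L : SubZ2) (ρ : M2R) : ℂ :=
  piL L ρ * ∏ L' ∈ (S N).filter (fun L' => L' < L), (1 - piL L' ρ)

lemma finite_torsion (N : ℕ) [NeZero N] : {a : Fin 2 → QmodZ | N • a = 0}.Finite := by
  have : Fact ((0 : ℚ) < 1) := ⟨one_pos⟩
  refine (Set.Finite.pi' (fun _ : Fin 2 =>
    AddCircle.finite_torsion (1 : ℚ) (Nat.pos_of_ne_zero (NeZero.ne N)))).subset ?_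
  intro a ha i
  exact congrFun ha i

/-- The finite set of `a ∈ (ℚ/ℤ)²` with `N a = 0`. -/
def torsion (N : ℕ) [NeZero N] : Finset (Fin 2 → QmodZ) := (finite_torsion N).toFinset

/-! ### The `ℚ`-lattice attached to `(ρ, τ)` and the functions `X_a` -/

/-- The periods `1, τ`. -/
def periods (τ : UpperHalfPlane) : PeriodPair where
  ω₁ := 1
  ω₂ := τ
  indep := by
    rw [LinearIndependent.pair_iff]
    intro s t h
    have him := congrArg Complex.im h
    have hre := congrArg Complex.re h
    have ht : t = 0 := by
      simpa [τ.im_ne_zero] using him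
    subst ht
    simpa using hre

/-- `Λ = ℤ + τ ℤ`. -/
def Lam (τ : UpperHalfPlane) : Submodule ℤ ℂ := (periods τ).lattice

/-- For `w ∈ Λ`, the map `ℚ/ℤ → ℂ/Λ` sending the class of `x ∈ ℚ` to the class of `x w`. -/
def mulPeriod (τ : UpperHalfPlane) (w : ℂ) (hw : w ∈ Lam τ) : QmodZ →+ ℂ ⧸ Lam τ :=
  QuotientAddGroup.lift (AddSubgroup.zmultiples (1 : ℚ))
    ((Lam τ).mkQ.toAddMonoidHom.comp
      ((AddMonoidHom.mulRight w).comp (Rat.castHom ℂ).toAddMonoidHom))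
    (by
      rintro x ⟨n, rfl⟩
      rw [AddMonoidHom.mem_ker]
      have h := (Lam τ).smul_mem n hw
      simpa [Submodule.Quotient.mk_eq_zero] using h)

/-- `φ(a) = ρ₁(a) - τ ρ₂(a) ∈ ℚΛ/Λ ⊆ ℂ/Λ`. -/
def phi (ρ : M2R) (τ : UpperHalfPlane) (a : Fin 2 → QmodZ) : ℂ ⧸ Lam τ :=
  mulPeriod τ 1 (periods τ).ω₁_mem_lattice (act ρ a 0) -
    mulPeriod τ τ (periods τ).ω₂_mem_lattice (act ρ a 1)

/-- The Weierstrass function `℘` of `Λ`, as a function on `ℂ/Λ`. -/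
def wp (τ : UpperHalfPlane) : ℂ ⧸ Lam τ → ℂ :=
  Quotient.lift (periods τ).weierstrassP (by
    intro x y h
    have h' : x - y ∈ (periods τ).lattice := (Submodule.quotientRel_def _).1 h
    have := (periods τ).weierstrassP_add_coe y ⟨x - y, h'⟩
    simpa using this)

open Classical in
/-- `X_a(ρ, τ) = π⁻² ℘(φ(a))` if `φ(a) ≠ 0` in `ℂ/Λ`, and `X_a(ρ, τ) = 0` otherwise. -/
def X (a : Fin 2 → QmodZ) (ρ : M2R) (τ : UpperHalfPlane) : ℂ :=
  if phi ρ τ a = 0 then 0 else ((Real.pi : ℂ) ^ 2)⁻¹ * wp τ (phi ρ τ a)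

/-! ### The Eisenstein cocycle of weight `2` -/

/-- `Δ|γ (τ) = det(γ)⁶ Δ(γ τ) (c τ + d)⁻¹²` for `γ ∈ GL₂⁺(ℚ)`. -/
def slashDelta (γ : GL(2, ℚ)⁺) (τ : UpperHalfPlane) : ℂ :=
  let g : GL (Fin 2) ℝ := Matrix.GeneralLinearGroup.map (algebraMap ℚ ℝ) γ.1
  ((g.det : ℝ) : ℂ) ^ 6 * ModularForm.discriminant (g • τ) *
    (((g 1 0 : ℝ) : ℂ) * τ + ((g 1 1 : ℝ) : ℂ)) ^ (-12 : ℤ)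

/-- The weight `2` Eisenstein cocycle `μ_γ = (1 / 6πi) (d/dτ) log (Δ|γ / Δ)`; with this
normalization `μ_γ (τ) = n e₂(n τ) - e₂(τ)` for `γ⁻¹ = diag(1, n)`, where
`e₂ = 1/3 - 8 ∑ σ₁(j) q^j`. -/
def mu (γ : GL(2, ℚ)⁺) (τ : UpperHalfPlane) : ℂ :=
  1 / (6 * Real.pi * Complex.I) *
    logDeriv (fun z : ℂ => slashDelta γ (UpperHalfPlane.ofComplex z) /
      ModularForm.discriminant (UpperHalfPlane.ofComplex z)) τ

/-- `m ∈ M₂(ℤ)⁺` as an element of `GL₂⁺(ℚ)`. -/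
def toGLPos (m : M2ZPos) : GL(2, ℚ)⁺ :=
  have h : 0 < (m.1.map (Int.castRingHom ℚ)).det := by
    have : (m.1.map (Int.castRingHom ℚ)).det = (m.1.det : ℚ) := by
      simpa using ((Int.castRingHom ℚ).map_det m.1).symm
    rw [this]
    exact_mod_cast m.2
  ⟨Matrix.GeneralLinearGroup.mkOfDetNeZero _ h.ne', h⟩

open Classical in
/-- `μ_L = μ_{m⁻¹}` where `m ∈ M₂(ℤ)⁺` and `m(ℤ²) = L`. -/
def muL (L : SubZ2) : UpperHalfPlane → ℂ :=
  if h : ∃ m : M2ZPos, latticeOf m.1 = L then mu (toGLPos h.choose)⁻¹ else 0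

/-- Modular forms of level `N` (that is, for the principal congruence subgroup `Γ(N)`) and
weight `2k`, holomorphic at the cusps. -/
abbrev MF (N k : ℕ) : Type :=
  ModularForm ((CongruenceSubgroup.Gamma N).map (Matrix.SpecialLinearGroup.mapGL ℝ)) (2 * (k : ℤ))

end DivisionRelations

end

noncomputable section

namespace DivisionRelations

/-! Since `X a ρ τ = X (act ρ a) 1 τ`, a power sum has the form `∑ g (ρ a)` over the `N`-torsion.
The fibres of `ρ` on this finite group all have the same size, so the sum depends on `ρ` only
through the image of the torsion, that is, through a lattice `imageLattice N ρ` in `S N`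
(`sum_torsion_act_congr`).

By divisibility of ℚ/ℤ, `ρ` lies in `m M₂(R)` exactly when this lattice lies in `m ℤ²`
(`exists_eq_toM2R_mul_iff`). Hence `π(N, L)` is the indicator of `imageLattice N ρ = L` (`piNL_eq`),
and the division relation says that the power sum is constant in `ρ` on each piece of this
partition. Every piece contains an integral matrix `m`; evaluating there defines `ω` and proves
uniqueness.

Modularity comes from `X_smul`: replacing `τ` by `γτ` amounts to replacing `ρ` by `γ⁻¹ρ`, up to the
automorphy factor, and Γ(N) fixes every lattice of `S N`. Holomorphy and boundedness come from
`weierstrassP_eq_tsum_rowSum`, which writes ℘ as a sum over rows minus `G2`.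

For `k = 1`, a triangular basis of `L` reduces the sum to distribution relations for row sums
(`sum_weierstrassP_triangular`). The result, a combination of two values of `G2`, is also the
logarithmic derivative defining `μ_L` (`mu_triangular`). -/

/-! ### Row sums of the Weierstrass function -/

/-- The sum `∑ 1 / (w + n)²` over the integers, with the convention `1 / 0 = 0`. -/
def rowSum (w : ℂ) : ℂ := ∑' n : ℤ, 1 / (w + n) ^ 2

lemma summable_one_div_add_int_sq (w : ℂ) : Summable fun n : ℤ => 1 / (w + n) ^ 2 := by
  have h := EisensteinSeries.linear_inv_isBigO_right 1 w
  have := EisensteinSeries.summable_inv_of_isBigO_rpow_inv (f := fun n : ℤ => (w + n) ^ 2)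
    (a := 2) (by norm_num) (by
      simpa [sq_abs] using (h.pow 2))
  simpa using this

lemma rowSum_neg (w : ℂ) : rowSum (-w) = rowSum w := by
  rw [rowSum, ← (Equiv.neg ℤ).tsum_eq]
  refine tsum_congr fun n => ?_
  simp only [Equiv.neg_apply, Int.cast_neg]
  congr 1
  ring

lemma rowSum_add_int (w : ℂ) (k : ℤ) : rowSum (w + k) = rowSum w := by
  rw [rowSum, rowSum, ← (Equiv.addLeft k).tsum_eq (fun n : ℤ => 1 / (w + n) ^ 2)]
  refine tsum_congr fun n => ?_
  simp [add_assoc]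

/-- Lipschitz's formula gives `(2πi)² ∑ n qⁿ`, and `∑ n qⁿ = q / (1 - q)²`. -/
lemma rowSum_eq_exp_of_pos {w : ℂ} (hw : 0 < w.im) :
    rowSum w = -4 * (Real.pi : ℂ) ^ 2 * Complex.exp (2 * Real.pi * Complex.I * w) /
      (1 - Complex.exp (2 * Real.pi * Complex.I * w)) ^ 2 := by
  have h := EisensteinSeries.qExpansion_identity (k := 1) le_rfl ⟨w, hw⟩
  have hq := UpperHalfPlane.norm_exp_two_pi_I_lt_one ⟨w, hw⟩
  simp only [pow_one] at h hq
  rw [tsum_coe_mul_geometric_of_norm_lt_one hq] at h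
  rw [rowSum]
  refine h.trans ?_
  simp [mul_pow]
  ring

/-- The expression `q / (1 - q)²` is invariant under `q ↦ q⁻¹`, so evenness carries the formula to
the lower half-plane. -/
lemma rowSum_eq_exp {w : ℂ} (hw : w.im ≠ 0) :
    rowSum w = -4 * (Real.pi : ℂ) ^ 2 * Complex.exp (2 * Real.pi * Complex.I * w) /
      (1 - Complex.exp (2 * Real.pi * Complex.I * w)) ^ 2 := by
  rcases lt_or_gt_of_ne hw with h | h
  · rw [← rowSum_neg, rowSum_eq_exp_of_pos (by simpa using h)]
    have h0 := Complex.exp_ne_zero (2 * Real.pi * Complex.I * w)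
    set q := Complex.exp (2 * Real.pi * Complex.I * w) with hq
    have : Complex.exp (2 * Real.pi * Complex.I * -w) = q⁻¹ := by
      rw [hq, ← Complex.exp_neg]; congr 1; ring
    rw [this]
    have h2 : (1 - q⁻¹) = (q - 1) / q := by field_simp
    rw [h2, show (1 - q) ^ 2 = (q - 1) ^ 2 by ring, div_pow]
    field_simp
  · exact rowSum_eq_exp_of_pos h

lemma exp_two_pi_I_mul_ne_one {w : ℂ} (hw : w.im ≠ 0) :
    Complex.exp (2 * Real.pi * Complex.I * w) ≠ 1 := by
  intro h
  have := congrArg norm h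
  rw [Complex.norm_exp] at this
  simp at this
  exact hw this

/-- With `s = π Im w > 0`, one has `|1 - q| ≥ 1 - e^(-2s) = 2 e^(-s) sinh s ≥ 2 s e^(-s)`, while the
numerator has norm `4π² e^(-2s)`. The bound is summable over the rows of a lattice. -/
lemma norm_rowSum_le {w : ℂ} (hw : w.im ≠ 0) : ‖rowSum w‖ ≤ 1 / w.im ^ 2 := by
  wlog h : 0 < w.im generalizing w
  · have := this (w := -w) (by simpa using hw)
      (by simpa using lt_of_le_of_ne (not_lt.1 h) hw)
    simpa [rowSum_neg] using this
  rw [rowSum_eq_exp hw]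
  set q := Complex.exp (2 * Real.pi * Complex.I * w) with hq
  have hpi := Real.pi_pos
  set s := Real.pi * w.im with hs
  have hs0 : 0 < s := by positivity
  have hnq : ‖q‖ = Real.exp (-s) ^ 2 := by
    rw [hq, Complex.norm_exp, ← Real.exp_nat_mul]
    congr 1
    simp [hs]
    ring
  have h1 : 1 - Real.exp (-s) ^ 2 ≤ ‖1 - q‖ := by
    have := norm_sub_norm_le (1 : ℂ) q
    simpa [hnq] using this
  have he : Real.exp (-s) * Real.exp s = 1 := by rw [← Real.exp_add]; simp
  have hsinh : s ≤ Real.sinh s := Real.self_le_sinh_iff.2 hs0.le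
  rw [Real.sinh_eq] at hsinh
  have hep := Real.exp_pos (-s)
  have h2 : 2 * s * Real.exp (-s) ≤ ‖1 - q‖ := by
    refine le_trans ?_ h1
    nlinarith
  have h3 : 0 < ‖1 - q‖ := lt_of_lt_of_le (by positivity) h2
  rw [norm_div, norm_pow, norm_mul, norm_mul, hnq]
  simp only [norm_neg, norm_pow, Complex.norm_real, Real.norm_eq_abs, abs_of_pos hpi]
  rw [div_le_div_iff₀ (by positivity) (by positivity)]
  have h4 : (2 * s * Real.exp (-s)) ^ 2 ≤ ‖1 - q‖ ^ 2 := by gcongr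
  simp only [Complex.norm_ofNat]
  calc 4 * Real.pi ^ 2 * Real.exp (-s) ^ 2 * w.im ^ 2 = (2 * s * Real.exp (-s)) ^ 2 := by
        rw [hs]; ring
    _ ≤ _ := by rw [one_mul]; exact h4

lemma differentiableAt_rowSum {w : ℂ} (hw : w.im ≠ 0) : DifferentiableAt ℂ rowSum w := by
  have h : rowSum =ᶠ[nhds w] fun w => -4 * (Real.pi : ℂ) ^ 2 *
      Complex.exp (2 * Real.pi * Complex.I * w) /
      (1 - Complex.exp (2 * Real.pi * Complex.I * w)) ^ 2 := by
    filter_upwards [(isOpen_ne.preimage Complex.continuous_im).mem_nhds hw] with z hz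
    exact rowSum_eq_exp hz
  rw [h.differentiableAt_iff]
  refine DifferentiableAt.div (by fun_prop) (by fun_prop) ?_
  exact pow_ne_zero _ (sub_ne_zero.2 (exp_two_pi_I_mul_ne_one hw).symm)

/-- A bound for the row sums along `v + (u + m) τ`, uniform for `Im τ ≥ δ`. -/
def rowBound (u v δ : ℝ) (m : ℤ) : ℝ :=
  -- At most one row has `u + m = 0`. It lies on the real axis, outside the scope of
  -- `norm_rowSum_le`, but does not vary with `τ`.
  (if u + m = 0 then ‖rowSum v‖ else 0) + ‖1 / ((u : ℂ) + m) ^ 2‖ * (1 / δ ^ 2)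

lemma summable_rowBound (u v δ : ℝ) : Summable (rowBound u v δ) := by
  refine Summable.add ?_ ((summable_one_div_add_int_sq u).norm.mul_right _)
  refine summable_of_hasFiniteSupport ((Set.finite_singleton (⌊-u⌋)).subset ?_)
  intro m hm
  have : u + m = 0 := by
    by_contra h
    simp [h] at hm
  have : -u = m := by linarith
  simp [this]

lemma norm_rowSum_le_rowBound (u v : ℝ) {δ : ℝ} (hδ : 0 < δ) (m : ℤ) {z : ℂ} (hz : δ ≤ z.im) :
    ‖rowSum (v + (u + m) * z)‖ ≤ rowBound u v δ m := by
  rw [rowBound]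
  by_cases h : u + m = 0
  · have h' : (u : ℂ) + m = 0 := by exact_mod_cast h
    rw [if_pos h, h']
    simp
  · rw [if_neg h, zero_add]
    have him : (v + (u + m) * z : ℂ).im = (u + m) * z.im := by
      simp
    have hz0 : 0 < z.im := hδ.trans_le hz
    have hne : (v + (u + m) * z : ℂ).im ≠ 0 := by
      rw [him]; exact mul_ne_zero h hz0.ne'
    refine (norm_rowSum_le hne).trans ?_
    rw [him]
    have : ‖1 / ((u : ℂ) + m) ^ 2‖ = 1 / (u + m) ^ 2 := by
      rw [norm_div, norm_pow, show (u : ℂ) + m = ((u + m : ℝ) : ℂ) by push_cast; rfl,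
        Complex.norm_real]
      simp
    rw [this, mul_pow, one_div_mul_one_div]
    have : 0 < (u + m) ^ 2 := by positivity
    gcongr

lemma summable_rowSum (u v : ℝ) {z : ℂ} (hz : 0 < z.im) :
    Summable fun m : ℤ => rowSum (v + (u + m) * z) :=
  Summable.of_norm_bounded (summable_rowBound u v z.im)
    fun m => norm_rowSum_le_rowBound u v hz m le_rfl

lemma differentiableAt_tsum_rowSum (u v : ℝ) {z : ℂ} (hz : 0 < z.im) :
    DifferentiableAt ℂ (fun z => ∑' m : ℤ, rowSum (v + (u + m) * z)) z := by
  have hopen : IsOpen {w : ℂ | z.im / 2 < w.im} := isOpen_lt continuous_const Complex.continuous_im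
  have := Complex.differentiableOn_tsum_of_summable_norm (summable_rowBound u v (z.im / 2))
    (F := fun (m : ℤ) (z : ℂ) => rowSum (v + (u + m) * z)) (fun m w hw => ?_) hopen
    (fun m w hw => norm_rowSum_le_rowBound u v (half_pos hz) m hw.le)
  · exact this.differentiableAt (hopen.mem_nhds (half_lt_self hz))
  · have hw0 : 0 < w.im := (half_pos hz).trans hw
    refine DifferentiableAt.differentiableWithinAt ?_
    by_cases h : u + m = 0
    · have h' : (u : ℂ) + m = 0 := by exact_mod_cast h
      simp [h']
    · refine DifferentiableAt.comp w (differentiableAt_rowSum ?_) (by fun_prop)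
      simp only [Complex.add_im, Complex.ofReal_im, Complex.mul_im, Complex.add_re,
        Complex.ofReal_re, Complex.intCast_re, Complex.intCast_im]
      simpa using ⟨h, hw0.ne'⟩

lemma norm_tsum_rowSum_le (u v : ℝ) {z : ℂ} (hz : 1 ≤ z.im) :
    ‖∑' m : ℤ, rowSum (v + (u + m) * z)‖ ≤ ∑' m, rowBound u v 1 m :=
  tsum_of_norm_bounded (summable_rowBound u v 1).hasSum
    fun m => norm_rowSum_le_rowBound u v one_pos m hz

lemma rowSum_int_mul (τ : UpperHalfPlane) (m : ℤ) :
    rowSum (m * τ) = EisensteinSeries.e2Summand m τ := by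
  rw [rowSum, EisensteinSeries.e2Summand]
  refine tsum_congr fun n => ?_
  simp [EisensteinSeries.eisSummand, zpow_neg]

lemma summable_rowSum_int_mul (τ : UpperHalfPlane) : Summable fun m : ℤ => rowSum (m * τ) := by
  simpa using summable_rowSum 0 0 τ.im_pos

/-- `G2` is a symmetric limit of row sums; these are absolutely summable, so the unconditional sum
agrees with it. -/
lemma tsum_rowSum_int_mul (τ : UpperHalfPlane) :
    ∑' m : ℤ, rowSum (m * τ) = EisensteinSeries.G2 τ := by
  rw [EisensteinSeries.G2, ← tsum_eq_of_summable_unconditional (L := SummationFilter.symmetricIcc ℤ)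
    (summable_rowSum_int_mul τ)]
  simp only [rowSum_int_mul]

/-- Eisenstein summation: grouped by rows, the two halves of the ℘-series converge separately, and
the second one is `G2`. Lattice points need no exclusion, because `1 / 0 = 0` on both sides. -/
lemma weierstrassP_eq_tsum_rowSum (u v : ℝ) (τ : UpperHalfPlane) :
    (periods τ).weierstrassP (v + u * τ) =
      ∑' m : ℤ, rowSum (v + (u + m) * τ) - EisensteinSeries.G2 τ := by
  set z : ℂ := v + u * τ with hz
  have h := (periods τ).hasSum_weierstrassP z
  let e : ℤ × ℤ ≃ (periods τ).lattice :=
    (((Equiv.prodComm ℤ ℤ).trans (Equiv.neg (ℤ × ℤ))).trans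
      (periods τ).latticeEquivProd.symm.toEquiv)
  have he : ∀ x : ℤ × ℤ, ((e x : (periods τ).lattice) : ℂ) = -(x.1 * τ + x.2) := by
    intro x
    have := (periods τ).latticeEquiv_symm_apply (-x.swap)
    refine this.trans ?_
    simp [periods]
  have h2 := (e.hasSum_iff (f := fun l : (periods τ).lattice =>
    (1 / (z - l) ^ 2 - 1 / (l : ℂ) ^ 2))).2 h
  rw [← h2.tsum_eq]
  simp only [Function.comp_def, he]
  have hrow : ∀ m : ℤ, HasSum (fun n : ℤ => 1 / (z - -(m * τ + n)) ^ 2 -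
      1 / (-((m : ℂ) * τ + n)) ^ 2) (rowSum (z + m * τ) - rowSum (m * τ)) := by
    intro m
    refine ((summable_one_div_add_int_sq (z + m * τ)).hasSum.sub
      (summable_one_div_add_int_sq (m * τ)).hasSum).congr_fun ?_
    intro n
    congr 2 <;> ring
  have h3 := h2.summable.hasSum.prod_fiberwise (g := fun m : ℤ => rowSum (z + m * τ) - rowSum (m * τ)) (by
    intro m
    simpa only [Function.comp_def, he] using hrow m)
  simp only [Function.comp_def, he] at h3
  rw [← h3.tsum_eq, ← tsum_rowSum_int_mul, ← Summable.tsum_sub (summable_rowSum u v τ.im_pos)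
    (summable_rowSum_int_mul τ)]
  refine tsum_congr fun m => ?_
  congr 2
  rw [hz]
  ring

/-! ### Distribution relations -/

/-- Each block of `B` consecutive `j` runs once through the residues mod `B`, hence once through ℤ;
there are `s` blocks. -/
lemma sum_range_tsum_add_mul {h : ℤ → ℂ} (hh : Summable h) (s B : ℕ) [NeZero B] :
    ∑ j ∈ Finset.range (s * B), ∑' m : ℤ, h (j + m * B) = s * ∑' m : ℤ, h m := by
  have hbase : ∑ j ∈ Finset.range B, ∑' m : ℤ, h (j + m * B) = ∑' m : ℤ, h m := by
    have h1 := ((Int.divModEquiv B).symm.hasSum_iff (f := h)).2 hh.hasSum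
    have h2 := (Equiv.prodComm (Fin B) ℤ).hasSum_iff.2 h1
    rw [← h2.tsum_eq, h2.summable.tsum_prod, tsum_fintype, Finset.sum_range]
    refine Finset.sum_congr rfl fun j _ => tsum_congr fun m => ?_
    simp [Int.divModEquiv, add_comm]
  induction s with
  | zero => simp
  | succ s ih =>
    rw [Nat.succ_mul, Finset.sum_range_add, ih, Nat.cast_succ, add_mul, one_mul, ← hbase]
    congr 1
    refine Finset.sum_congr rfl fun j _ => ?_
    rw [← (Equiv.addRight (-(s : ℤ))).tsum_eq]
    refine (tsum_congr fun m => ?_).symm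
    congr 1
    simp
    ring

lemma sum_range_rowSum (w : ℂ) (p A : ℕ) [NeZero A] :
    ∑ i ∈ Finset.range (p * A), rowSum (w + i / A) = p * A ^ 2 * rowSum (A * w) := by
  have hA : (A : ℂ) ≠ 0 := Nat.cast_ne_zero.2 (NeZero.ne A)
  have h := sum_range_tsum_add_mul ((summable_one_div_add_int_sq (A * w)).mul_left ((A : ℂ) ^ 2)) p A
  rw [tsum_mul_left] at h
  rw [mul_assoc, rowSum, ← h]
  refine Finset.sum_congr rfl fun i _ => tsum_congr fun n => ?_
  push_cast
  rw [show (A : ℂ) * w + (i + n * A) = A * (w + i / A + n) by field_simp; ring, mul_pow,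
    mul_one_div, div_mul_eq_div_div, div_self (pow_ne_zero _ hA)]

/-- The sum over `i` merges the rows into rows of `ℤ + τ'ℤ`, with factor `p A²`; the sum over `j`
then covers all of these `s` times. The constant is `p A² s = N² s / p`. -/
lemma sum_weierstrassP_triangular {N p s A B : ℕ} [NeZero N] (hA : N = p * A) (hB : N = s * B)
    {q x : ℤ} (hx : B * q = x * p) (τ τ' : UpperHalfPlane) (hτ : (τ' : ℂ) = (s * τ - q) / p) :
    ∑ i ∈ Finset.range N, ∑ j ∈ Finset.range N, (periods τ).weierstrassP
      (((p * i + q * j) / N : ℝ) + ((-(s * j) / N : ℝ) : ℂ) * τ) =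
      N ^ 2 * (s / p * EisensteinSeries.G2 τ' - EisensteinSeries.G2 τ) := by
  have hN : (N : ℂ) ≠ 0 := Nat.cast_ne_zero.2 (NeZero.ne N)
  have hA0 : A ≠ 0 := by rintro rfl; exact NeZero.ne N (by simpa using hA)
  have hp0 : p ≠ 0 := by rintro rfl; exact NeZero.ne N (by simpa using hA)
  have hB0 : B ≠ 0 := by rintro rfl; exact NeZero.ne N (by simpa using hB)
  have : NeZero A := ⟨hA0⟩
  have : NeZero B := ⟨hB0⟩
  have hAC : (N : ℂ) = p * A := by exact_mod_cast hA
  have hBC : (N : ℂ) = s * B := by exact_mod_cast hB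
  have hxC : (B : ℂ) * q = x * p := by exact_mod_cast hx
  have hpC : (p : ℂ) ≠ 0 := Nat.cast_ne_zero.2 hp0
  have hA0C : (A : ℂ) ≠ 0 := Nat.cast_ne_zero.2 hA0
  have hinner : ∀ j : ℕ, ∑ i ∈ Finset.range N, ∑' m : ℤ,
      rowSum (((p * i + q * j) / N : ℝ) + (((-(s * j) / N : ℝ) : ℂ) + m) * τ) =
      p * A ^ 2 * ∑' m : ℤ, rowSum (((j + m * B : ℤ) : ℂ) * τ') := by
    intro j
    rw [← Summable.tsum_finsetSum fun i _ => summable_rowSum _ _ τ.im_pos, ← tsum_mul_left,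
      ← (Equiv.neg ℤ).tsum_eq (fun m : ℤ => (p : ℂ) * A ^ 2 * rowSum (((j + m * B : ℤ) : ℂ) * τ'))]
    refine tsum_congr fun m => ?_
    have h1 := sum_range_rowSum (q * j / N + (-(s * j) / N + m) * τ) p A
    rw [← hA] at h1
    refine Eq.trans (Finset.sum_congr rfl fun i _ => ?_) (h1.trans ?_)
    · congr 1
      push_cast
      rw [hAC]
      field_simp
      ring
    · congr 1
      -- By `hx`, `B τ' = A τ - x`, so up to sign the two arguments differ by the integer `m x`.
      rw [← rowSum_neg, ← rowSum_add_int _ (m * x)]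
      congr 1
      simp only [Equiv.neg_apply]
      push_cast
      rw [hτ, hAC]
      have h2 : (p : ℂ) * A = s * B := hAC.symm.trans hBC
      field_simp
      linear_combination (-(m : ℂ)) * hxC - (m : ℂ) * τ * h2
  have h3 := sum_range_tsum_add_mul (summable_rowSum_int_mul τ') s B
  rw [tsum_rowSum_int_mul, ← hB] at h3
  simp only [weierstrassP_eq_tsum_rowSum, Finset.sum_sub_distrib, Finset.sum_const,
    Finset.card_range, nsmul_eq_mul]
  rw [Finset.sum_comm, Finset.sum_congr rfl fun j _ => hinner j, ← Finset.mul_sum, h3, hAC]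
  field_simp

/-! ### Lattices between `N ℤ²` and `ℤ²` -/

lemma mem_S {N : ℕ} [NeZero N] {L : SubZ2} : L ∈ S N ↔ NZ2 N ≤ L := by
  simp [S]

lemma mem_torsion {N : ℕ} [NeZero N] {a : Fin 2 → QmodZ} : a ∈ torsion N ↔ N • a = 0 := by
  simp [torsion]

lemma mem_NZ2 {N : ℕ} {x : Fin 2 → ℤ} : x ∈ NZ2 N ↔ ∃ y : Fin 2 → ℤ, x = (N : ℤ) • y := by
  simp [NZ2, eq_comm]

lemma mem_latticeOf {m : Matrix (Fin 2) (Fin 2) ℤ} {x : Fin 2 → ℤ} :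
    x ∈ latticeOf m ↔ ∃ y, m.mulVec y = x := by
  simp [latticeOf]

/-- Hermite normal form: `p` generates `L ∩ (ℤ × 0)`, `s` generates the second projection of `L`,
and `(q, s)` is a lift of `s`. Both divide `N` as `N ℤ² ⊆ L`, and `B (q, s) - (0, N) = (B q, 0)` in
`L` forces `p ∣ B q`. -/
lemma exists_triangular {N : ℕ} [NeZero N] {L : SubZ2} (hL : NZ2 N ≤ L) :
    ∃ (p s A B : ℕ) (q x : ℤ), N = p * A ∧ N = s * B ∧ B * q = x * p ∧
      L = latticeOf !![(p : ℤ), q; 0, (s : ℤ)] := by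
  have hNZ : ∀ y : Fin 2 → ℤ, (N : ℤ) • y ∈ L := fun y => hL (mem_NZ2.2 ⟨y, rfl⟩)
  let I₁ : Ideal ℤ := L.comap (LinearMap.single ℤ (fun _ : Fin 2 => ℤ) 0)
  let I₂ : Ideal ℤ := L.map (LinearMap.proj (R := ℤ) (φ := fun _ : Fin 2 => ℤ) 1)
  have h₁ : ∀ a : ℤ, a ∈ I₁ ↔ ![a, 0] ∈ L := by
    intro a
    have : (LinearMap.single ℤ (fun _ : Fin 2 => ℤ) 0) a = ![a, 0] := by
      ext i; fin_cases i <;> simp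
    rw [← this]; rfl
  have h₂ : ∀ b : ℤ, b ∈ I₂ ↔ ∃ a, ![a, b] ∈ L := by
    intro b
    constructor
    · rintro ⟨x, hx, rfl⟩
      refine ⟨x 0, ?_⟩
      convert! hx using 1
      ext i; fin_cases i <;> simp
    · rintro ⟨a, h⟩
      exact ⟨_, h, by simp⟩
  have hgen : ∀ I : Ideal ℤ, (N : ℤ) ∈ I → ∃ n A : ℕ, N = n * A ∧ ∀ a, a ∈ I ↔ (n : ℤ) ∣ a := by
    intro I hI
    have hdvd : ∀ a, a ∈ I ↔ ((Submodule.IsPrincipal.generator I).natAbs : ℤ) ∣ a := fun a => by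
      rw [Submodule.IsPrincipal.mem_iff_generator_dvd, Int.natAbs_dvd]
    obtain ⟨A, hA⟩ := Int.natCast_dvd_natCast.1 ((hdvd _).1 hI)
    exact ⟨_, A, hA, hdvd⟩
  obtain ⟨p, A, hA, hp⟩ := hgen I₁ ((h₁ _).2 (by
    convert! hNZ ![1, 0] using 1; simp))
  obtain ⟨s, B, hB, hs⟩ := hgen I₂ ((h₂ _).2 ⟨0, by
    convert! hNZ ![0, 1] using 1; simp⟩)
  obtain ⟨q, hq⟩ := (h₂ _).1 ((hs s).2 dvd_rfl)
  have hBq : ![(B : ℤ) * q, 0] ∈ L := by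
    convert! L.sub_mem (L.smul_mem (B : ℤ) hq) (hNZ ![0, 1]) using 1
    have : (N : ℤ) = s * B := by exact_mod_cast hB
    simp [this, mul_comm]
  obtain ⟨x, hx⟩ := (hp _).1 ((h₁ _).2 hBq)
  have hpL : ![(p : ℤ), 0] ∈ L := (h₁ _).1 ((hp p).2 dvd_rfl)
  refine ⟨p, s, A, B, q, x, hA, hB, by rw [hx, mul_comm], le_antisymm ?_ ?_⟩
  · intro y hy
    rw [mem_latticeOf]
    obtain ⟨t, ht⟩ := (hs (y 1)).1 ((h₂ _).2 ⟨y 0, by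
      convert! hy using 1; ext i; fin_cases i <;> simp⟩)
    have h3 : ![y 0 - t * q, 0] ∈ L := by
      convert! L.sub_mem hy (L.smul_mem t hq) using 1
      ext i; fin_cases i <;> simp [ht, mul_comm]
    obtain ⟨r, hr⟩ := (hp _).1 ((h₁ _).2 h3)
    refine ⟨![r, t], ?_⟩
    ext i
    fin_cases i
    · simp [Matrix.mulVec, dotProduct, Fin.sum_univ_two]
      linarith
    · simp [Matrix.mulVec, dotProduct, Fin.sum_univ_two, ht]
  · intro y hy
    obtain ⟨z, rfl⟩ := mem_latticeOf.1 hy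
    convert! L.add_mem (L.smul_mem (z 0) hpL) (L.smul_mem (z 1) hq) using 1
    ext i
    fin_cases i <;> simp [Matrix.mulVec, dotProduct, Fin.sum_univ_two, mul_comm]

lemma exists_latticeOf_eq {N : ℕ} [NeZero N] {L : SubZ2} (hL : L ∈ S N) :
    ∃ m : M2ZPos, latticeOf m.1 = L := by
  obtain ⟨p, s, A, B, q, x, hA, hB, -, h⟩ := exists_triangular (mem_S.1 hL)
  refine ⟨⟨!![(p : ℤ), q; 0, (s : ℤ)], ?_⟩, h.symm⟩
  have hp0 : p ≠ 0 := by rintro rfl; exact NeZero.ne N (by simpa using hA)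
  have hs0 : s ≠ 0 := by rintro rfl; exact NeZero.ne N (by simpa using hB)
  rw [Matrix.det_fin_two_of]
  simp only [mul_zero, sub_zero]
  positivity

/-! ### The action of `M₂(R)` on torsion points -/

lemma end_mul_apply (f g : R) (x : QmodZ) : (f * g) x = f (g x) := rfl

lemma end_add_apply (f g : R) (x : QmodZ) : (f + g) x = f x + g x := rfl

lemma end_one_apply (x : QmodZ) : (1 : R) x = x := rfl

lemma act_one (a : Fin 2 → QmodZ) : act 1 a = a := by
  ext i
  fin_cases i <;> simp [act, Fin.sum_univ_two, Matrix.one_apply, end_one_apply]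

lemma act_mul (ρ σ : M2R) (a : Fin 2 → QmodZ) : act (ρ * σ) a = act ρ (act σ a) := by
  ext i
  simp only [act, Matrix.mul_apply, Fin.sum_univ_two, end_add_apply, end_mul_apply, map_add]
  abel

/-- The action of `ρ ∈ M₂(R)` as a homomorphism. -/
def actHom (ρ : M2R) : (Fin 2 → QmodZ) →+ (Fin 2 → QmodZ) where
  toFun := act ρ
  map_zero' := by ext i; simp [act]
  map_add' a b := by
    ext i
    simp [act, Finset.sum_add_distrib]

lemma actHom_apply (ρ : M2R) (a : Fin 2 → QmodZ) : actHom ρ a = act ρ a := rfl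

lemma toM2R_mul (m n : Matrix (Fin 2) (Fin 2) ℤ) : toM2R (m * n) = toM2R m * toM2R n :=
  Matrix.map_mul (f := Int.castRingHom R)

lemma toM2R_one : toM2R 1 = 1 :=
  Matrix.map_one (Int.castRingHom R) (map_zero _) (map_one _)

lemma act_toM2R_coe (m : Matrix (Fin 2) (Fin 2) ℤ) (v : Fin 2 → ℚ) :
    act (toM2R m) (fun i => (v i : QmodZ)) =
      fun i => (((m.map (Int.cast : ℤ → ℚ)).mulVec v i : ℚ) : QmodZ) := by
  ext i
  simp [act, toM2R, Matrix.mulVec, dotProduct, Fin.sum_univ_two, AddMonoid.End.intCast_apply]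

/-- The class of `x / N` in `(ℚ/ℤ)²`, for `x ∈ ℤ²`. -/
def divClass (N : ℕ) : (Fin 2 → ℤ) →+ (Fin 2 → QmodZ) where
  toFun x i := ((x i / N : ℚ) : QmodZ)
  map_zero' := by ext i; simp
  map_add' x y := by
    ext i
    simp [add_div]

lemma divClass_apply (N : ℕ) (x : Fin 2 → ℤ) :
    divClass N x = fun i => ((x i / N : ℚ) : QmodZ) := rfl

lemma divClass_eq_zero {N : ℕ} [NeZero N] {x : Fin 2 → ℤ} :
    divClass N x = 0 ↔ x ∈ NZ2 N := by
  have hN : (N : ℚ) ≠ 0 := Nat.cast_ne_zero.2 (NeZero.ne N)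
  rw [mem_NZ2]
  constructor
  · intro h
    have : ∀ i, ∃ n : ℤ, x i = N * n := fun i => by
      obtain ⟨n, hn⟩ := (AddCircle.coe_eq_zero_iff (1 : ℚ)).1 (congrFun h i)
      refine ⟨n, ?_⟩
      have : (n : ℚ) = x i / N := by simpa using hn
      field_simp at this
      rw [mul_comm]
      exact_mod_cast this.symm
    choose y hy using this
    exact ⟨y, by ext i; simp [hy]⟩
  · rintro ⟨y, rfl⟩
    ext i
    refine (AddCircle.coe_eq_zero_iff (1 : ℚ)).2 ⟨y i, ?_⟩
    simp [hN]

lemma divClass_mem_torsion {N : ℕ} [NeZero N] (x : Fin 2 → ℤ) : divClass N x ∈ torsion N := by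
  rw [mem_torsion, ← map_nsmul, divClass_eq_zero, mem_NZ2]
  exact ⟨x, by simp⟩

lemma exists_divClass_eq {N : ℕ} [NeZero N] {a : Fin 2 → QmodZ} (ha : a ∈ torsion N) :
    ∃ x, divClass N x = a := by
  have hN : (N : ℚ) ≠ 0 := Nat.cast_ne_zero.2 (NeZero.ne N)
  rw [mem_torsion] at ha
  have : ∀ i, ∃ n : ℤ, ((n / N : ℚ) : QmodZ) = a i := fun i => by
    obtain ⟨v, hv⟩ := QuotientAddGroup.mk_surjective (a i)
    have h : ((N • v : ℚ) : QmodZ) = 0 := by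
      rw [AddCircle.coe_nsmul]
      exact (congrArg (N • ·) hv).trans (congrFun ha i)
    obtain ⟨n, hn⟩ := (AddCircle.coe_eq_zero_iff (1 : ℚ)).1 h
    refine ⟨n, ?_⟩
    rw [← hv]
    have : (n : ℚ) / N = v := by
      have : (n : ℚ) = N * v := by simpa using hn
      rw [this]; field_simp
    rw [this]
  choose x hx using this
  exact ⟨x, funext hx⟩

lemma act_toM2R_divClass {N : ℕ} (m : Matrix (Fin 2) (Fin 2) ℤ) (x : Fin 2 → ℤ) :
    act (toM2R m) (divClass N x) = divClass N (m.mulVec x) := by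
  rw [divClass_apply, act_toM2R_coe, divClass_apply]
  ext i
  congr 1
  simp [Matrix.mulVec, dotProduct, Fin.sum_univ_two]
  ring

/-- The lattice of all `x ∈ ℤ²` such that `x / N` is the image under `ρ` of an `N`-torsion point. -/
def imageLattice (N : ℕ) (ρ : M2R) : SubZ2 :=
  AddSubgroup.toIntSubmodule
    (((AddMonoidHom.range ((actHom ρ).comp (divClass N)))).comap (divClass N))

lemma mem_imageLattice {N : ℕ} {ρ : M2R} {x : Fin 2 → ℤ} :
    x ∈ imageLattice N ρ ↔ ∃ y, act ρ (divClass N y) = divClass N x := Iff.rfl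

lemma imageLattice_mem_S (N : ℕ) [NeZero N] (ρ : M2R) : imageLattice N ρ ∈ S N := by
  rw [mem_S]
  intro x hx
  rw [mem_imageLattice]
  refine ⟨0, ?_⟩
  rw [divClass_eq_zero.2 hx, map_zero, ← actHom_apply, map_zero]

lemma act_mem_torsion {N : ℕ} [NeZero N] (ρ : M2R) {a : Fin 2 → QmodZ} (ha : a ∈ torsion N) :
    act ρ a ∈ torsion N := by
  rw [mem_torsion] at ha ⊢
  rw [← actHom_apply, ← map_nsmul, ha, map_zero]

lemma imageLattice_toM2R {N : ℕ} [NeZero N] {m : Matrix (Fin 2) (Fin 2) ℤ}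
    (hm : NZ2 N ≤ latticeOf m) : imageLattice N (toM2R m) = latticeOf m := by
  ext x
  rw [mem_imageLattice]
  constructor
  · rintro ⟨y, hy⟩
    rw [act_toM2R_divClass, ← sub_eq_zero, ← map_sub, divClass_eq_zero] at hy
    have := (latticeOf m).sub_mem (mem_latticeOf.2 ⟨y, rfl⟩) (hm hy)
    rwa [sub_sub_cancel] at this
  · intro h
    obtain ⟨y, rfl⟩ := mem_latticeOf.1 h
    exact ⟨y, act_toM2R_divClass m y⟩

lemma imageLattice_toM2R_mul {N : ℕ} [NeZero N] (γ : SL(2, ℤ)) (ρ : M2R) :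
    imageLattice N (toM2R γ * ρ) = smulLattice γ (imageLattice N ρ) := by
  have h1 : ((γ⁻¹ : SL(2, ℤ)) : Matrix (Fin 2) (Fin 2) ℤ) * (γ : Matrix (Fin 2) (Fin 2) ℤ) = 1 := by
    rw [← Matrix.SpecialLinearGroup.coe_mul, inv_mul_cancel, Matrix.SpecialLinearGroup.coe_one]
  have h2 : (γ : Matrix (Fin 2) (Fin 2) ℤ) * ((γ⁻¹ : SL(2, ℤ)) : Matrix (Fin 2) (Fin 2) ℤ) = 1 := by
    rw [← Matrix.SpecialLinearGroup.coe_mul, mul_inv_cancel, Matrix.SpecialLinearGroup.coe_one]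
  ext x
  constructor
  · intro h
    obtain ⟨y, hy⟩ := mem_imageLattice.1 h
    refine ⟨((γ⁻¹ : SL(2, ℤ)) : Matrix (Fin 2) (Fin 2) ℤ).mulVec x, mem_imageLattice.2 ⟨y, ?_⟩, ?_⟩
    · rw [← act_toM2R_divClass, ← hy, ← act_mul, ← mul_assoc, ← toM2R_mul, h1, toM2R_one, one_mul]
    · rw [Matrix.mulVecLin_apply, Matrix.mulVec_mulVec, h2, Matrix.one_mulVec]
  · rintro ⟨z, hz, rfl⟩
    obtain ⟨y, hy⟩ := mem_imageLattice.1 hz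
    refine mem_imageLattice.2 ⟨y, ?_⟩
    rw [act_mul, hy, act_toM2R_divClass]
    rfl

/-! ### The idempotents `π(N, L)` -/

/-- Multiplication by `N` is surjective on the divisible group ℚ/ℤ, and `f` kills its kernel, so `f`
factors through it. -/
lemma exists_natCast_mul_of_torsion {N : ℕ} [NeZero N] {f : R}
    (hf : ∀ a : QmodZ, N • a = 0 → f a = 0) : ∃ g : R, f = N * g := by
  have hN : (N : ℚ) ≠ 0 := Nat.cast_ne_zero.2 (NeZero.ne N)
  let e : QmodZ →+ QmodZ := nsmulAddMonoidHom N
  have he : Function.Surjective e := by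
    intro a
    obtain ⟨v, rfl⟩ := QuotientAddGroup.mk_surjective a
    refine ⟨((v / N : ℚ) : QmodZ), ?_⟩
    change N • ((v / N : ℚ) : QmodZ) = (v : QmodZ)
    rw [← AddCircle.coe_nsmul]
    congr 1
    simp
    field_simp
  have hker : e.ker ≤ f.ker := fun a ha => hf a ha
  refine ⟨e.liftOfSurjective he ⟨f, hker⟩, ?_⟩
  ext a
  have h := AddMonoidHom.liftOfRightInverse_comp_apply e _ (Function.rightInverse_surjInv he) ⟨f, hker⟩ a
  refine h.symm.trans ?_
  exact map_nsmul (e.liftOfSurjective he ⟨f, hker⟩) N a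

lemma exists_natCast_smul_of_act_eq_zero {N : ℕ} [NeZero N] {ρ : M2R}
    (hρ : ∀ a ∈ torsion N, act ρ a = 0) : ∃ ν : M2R, ρ = N • ν := by
  have : ∀ i j, ∃ g : R, ρ i j = N * g := fun i j => by
    refine exists_natCast_mul_of_torsion fun a ha => ?_
    have h := congrFun (hρ (Pi.single j a) (by
      rw [mem_torsion, ← Pi.single_smul, ha, Pi.single_zero])) i
    simpa [act, Pi.single_apply, apply_ite, Finset.sum_ite_eq'] using h
  choose g hg using this
  exact ⟨Matrix.of g, by ext1 i j; simp [hg]⟩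

lemma nsmul_M2R_injective (N : ℕ) [NeZero N] {ρ σ : M2R} (h : N • ρ = N • σ) : ρ = σ := by
  have hN : (N : ℚ) ≠ 0 := Nat.cast_ne_zero.2 (NeZero.ne N)
  ext i j a
  obtain ⟨v, rfl⟩ := QuotientAddGroup.mk_surjective a
  have hv : (QuotientAddGroup.mk v : QmodZ) = N • ((v / N : ℚ) : QmodZ) := by
    rw [← AddCircle.coe_nsmul]
    congr 1
    simp
    field_simp
  rw [hv, map_nsmul, map_nsmul]
  exact DFunLike.congr_fun (congrFun (congrFun h i) j) ((v / N : ℚ) : QmodZ)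

/-- The matrix is `N m⁻¹`, integral because `N ℤ² ⊆ m ℤ²`. -/
lemma exists_complement {N : ℕ} [NeZero N] {m : Matrix (Fin 2) (Fin 2) ℤ}
    (hm : NZ2 N ≤ latticeOf m) : ∃ m' : Matrix (Fin 2) (Fin 2) ℤ, m * m' = (N : ℤ) • 1 ∧ m' * m = (N : ℤ) • 1 := by
  have : ∀ j, ∃ y, m.mulVec y = (N : ℤ) • Pi.single j 1 := fun j =>
    mem_latticeOf.1 (hm (mem_NZ2.2 ⟨_, rfl⟩))
  choose y hy using this
  have h1 : m * (Matrix.of fun i j => y j i) = (N : ℤ) • 1 := by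
    ext i j
    have := congrFun (hy j) i
    rw [Matrix.smul_apply, Matrix.one_apply]
    simpa [Matrix.mulVec, dotProduct, Matrix.mul_apply, Pi.single_apply] using this
  refine ⟨_, h1, ?_⟩
  have hdet : m.det ≠ 0 := by
    intro h0
    have := congrArg Matrix.det h1
    rw [Matrix.det_mul, h0, zero_mul, Matrix.det_smul] at this
    simp at this
    exact NeZero.ne N (by exact_mod_cast pow_eq_zero_iff two_ne_zero |>.1 this.symm)
  set m' := Matrix.of fun i j => y j i
  have h2 : m.det • (m' * m) = m.det • ((N : ℤ) • 1 : Matrix (Fin 2) (Fin 2) ℤ) := by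
    calc m.det • (m' * m) = (m.adjugate * m) * (m' * m) := by
          rw [Matrix.adjugate_mul, Matrix.smul_mul, one_mul]
      _ = m.adjugate * (m * m') * m := by simp only [mul_assoc]
      _ = (N : ℤ) • (m.adjugate * m) := by
          rw [h1, Matrix.mul_smul, mul_one, Matrix.smul_mul]
      _ = _ := by rw [Matrix.adjugate_mul, smul_comm]
  ext i j
  have := congrFun (congrFun h2 i) j
  exact mul_left_cancel₀ hdet this

lemma toM2R_nsmul_one (N : ℕ) : toM2R ((N : ℤ) • 1) = N • 1 := by
  ext1 i j
  rw [toM2R, Matrix.map_apply, Matrix.smul_apply, Matrix.smul_apply, Matrix.one_apply,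
    Matrix.one_apply]
  split_ifs <;> simp

/-- For the converse, let `m' = N m⁻¹`. If the image lies in `m ℤ²`, then `m' ρ` kills the
`N`-torsion, so `m' ρ = N ν`; multiplying by `m` gives `N ρ = N m ν`, and `N` cancels since `M₂(R)`
is torsion-free. -/
lemma exists_eq_toM2R_mul_iff {N : ℕ} [NeZero N] {m : Matrix (Fin 2) (Fin 2) ℤ}
    (hm : NZ2 N ≤ latticeOf m) (ρ : M2R) :
    (∃ ν : M2R, ρ = toM2R m * ν) ↔ imageLattice N ρ ≤ latticeOf m := by
  constructor
  · rintro ⟨ν, rfl⟩ x hx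
    obtain ⟨y, hy⟩ := mem_imageLattice.1 hx
    obtain ⟨z, hz⟩ := exists_divClass_eq (act_mem_torsion ν (divClass_mem_torsion (N := N) y))
    rw [← imageLattice_toM2R hm, mem_imageLattice]
    exact ⟨z, by rw [hz, ← act_mul, hy]⟩
  · intro h
    obtain ⟨m', h1, h2⟩ := exists_complement hm
    obtain ⟨ν, hν⟩ := exists_natCast_smul_of_act_eq_zero (N := N) (ρ := toM2R m' * ρ) (by
      intro a ha
      obtain ⟨y, rfl⟩ := exists_divClass_eq ha
      obtain ⟨x, hx⟩ := exists_divClass_eq (act_mem_torsion ρ ha)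
      obtain ⟨z, rfl⟩ := mem_latticeOf.1 (h (mem_imageLattice.2 ⟨y, hx.symm⟩))
      rw [act_mul, ← hx, act_toM2R_divClass, Matrix.mulVec_mulVec, h2, divClass_eq_zero, mem_NZ2]
      exact ⟨z, by rw [Matrix.smul_mulVec, Matrix.one_mulVec]⟩)
    refine ⟨ν, nsmul_M2R_injective N ?_⟩
    have hcomm : toM2R m * (N • ν) = N • (toM2R m * ν) :=
      map_nsmul (AddMonoidHom.mulLeft (toM2R m)) N ν
    rw [← hcomm, ← hν, ← mul_assoc, ← toM2R_mul, h1, toM2R_nsmul_one, smul_mul_assoc,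
      one_mul]

open Classical in
lemma piL_eq {N : ℕ} [NeZero N] {L : SubZ2} (hL : L ∈ S N) (ρ : M2R) :
    piL L ρ = if imageLattice N ρ ≤ L then 1 else 0 := by
  rw [piL]
  congr 1
  apply propext
  constructor
  · rintro ⟨m, rfl, h⟩
    exact (exists_eq_toM2R_mul_iff (mem_S.1 hL) ρ).1 h
  · intro h
    obtain ⟨m, rfl⟩ := exists_latticeOf_eq hL
    exact ⟨m, rfl, (exists_eq_toM2R_mul_iff (mem_S.1 hL) ρ).2 h⟩

-- If the image lattice is strictly below `L`, its own factor `1 - π_{L'}` vanishes; if it equals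
-- `L`, no smaller `L'` contains it and all factors are `1`.
open Classical in
lemma piNL_eq {N : ℕ} [NeZero N] {L : SubZ2} (hL : L ∈ S N) (ρ : M2R) :
    piNL N L ρ = if L = imageLattice N ρ then 1 else 0 := by
  rw [piNL, piL_eq hL]
  by_cases h : L = imageLattice N ρ
  · rw [if_pos h, if_pos h.ge, one_mul]
    refine Finset.prod_eq_one fun L' hL' => ?_
    obtain ⟨h1, h2⟩ := Finset.mem_filter.1 hL'
    rw [piL_eq h1, if_neg (h ▸ h2.not_ge), sub_zero]
  · rw [if_neg h]
    by_cases h' : imageLattice N ρ ≤ L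
    · rw [Finset.prod_eq_zero (i := imageLattice N ρ), mul_zero]
      · exact Finset.mem_filter.2 ⟨imageLattice_mem_S N ρ, lt_of_le_of_ne h' (Ne.symm h)⟩
      · rw [piL_eq (imageLattice_mem_S N ρ), if_pos le_rfl, sub_self]
    · rw [if_neg h', zero_mul]

lemma sum_piNL_mul {N : ℕ} [NeZero N] (ρ : M2R) (f : SubZ2 → ℂ) :
    ∑ L ∈ S N, piNL N L ρ * f L = f (imageLattice N ρ) := by
  classical
  rw [Finset.sum_eq_single_of_mem _ (imageLattice_mem_S N ρ)]
  · rw [piNL_eq (imageLattice_mem_S N ρ), if_pos rfl, one_mul]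
  · intro L hL hne
    rw [piNL_eq hL, if_neg hne, zero_mul]

/-! ### Sums over torsion points -/

/-- The double sum of `g (f a + c)` is evaluated twice, absorbing `c` by a translation of `T` or `f
a` by a translation of `U`. This replaces a count of the fibres of `f`. -/
lemma card_range_mul_sum {G H : Type*} [AddCommGroup G] [AddCommGroup H] (s : Finset G)
    (T : AddSubgroup G) (hs : ∀ a, a ∈ s ↔ a ∈ T) (t : Finset H) (U : AddSubgroup H)
    (ht : ∀ c, c ∈ t ↔ c ∈ U) (f : G →+ H) (hU : T.map f = U) (g : H → ℂ) :
    t.card * ∑ a ∈ s, g (f a) = s.card * ∑ c ∈ t, g c := by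
  have h1 : ∀ c ∈ t, ∑ a ∈ s, g (f a + c) = ∑ a ∈ s, g (f a) := by
    intro c hc
    rw [ht, ← hU] at hc
    obtain ⟨b, hb, rfl⟩ := hc
    refine Finset.sum_bij' (fun a _ => a + b) (fun a _ => a - b) ?_ ?_ ?_ ?_ ?_
    · intro a ha; rw [hs] at ha ⊢; exact T.add_mem ha hb
    · intro a ha; rw [hs] at ha ⊢; exact T.sub_mem ha hb
    · intro a _; simp
    · intro a _; simp
    · intro a _; simp
  have h2 : ∀ a ∈ s, ∑ c ∈ t, g (f a + c) = ∑ c ∈ t, g c := by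
    intro a ha
    rw [hs] at ha
    have hfa : f a ∈ U := hU ▸ AddSubgroup.mem_map_of_mem f ha
    refine Finset.sum_bij' (fun c _ => f a + c) (fun c _ => -f a + c) ?_ ?_ ?_ ?_ ?_
    · intro c hc; rw [ht] at hc ⊢; exact U.add_mem hfa hc
    · intro c hc; rw [ht] at hc ⊢; exact U.add_mem (U.neg_mem hfa) hc
    · intro a _; simp
    · intro a _; simp
    · intro a _; simp
  calc (t.card : ℂ) * ∑ a ∈ s, g (f a) = ∑ c ∈ t, ∑ a ∈ s, g (f a + c) := by
        rw [Finset.sum_congr rfl h1, Finset.sum_const, nsmul_eq_mul]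
    _ = ∑ a ∈ s, ∑ c ∈ t, g (f a + c) := Finset.sum_comm
    _ = _ := by rw [Finset.sum_congr rfl h2, Finset.sum_const, nsmul_eq_mul]

lemma sum_torsion_act_congr {N : ℕ} [NeZero N] {ρ σ : M2R}
    (h : imageLattice N ρ = imageLattice N σ) (g : (Fin 2 → QmodZ) → ℂ) :
    ∑ a ∈ torsion N, g (act ρ a) = ∑ a ∈ torsion N, g (act σ a) := by
  classical
  let T : AddSubgroup (Fin 2 → QmodZ) := (nsmulAddMonoidHom N).ker
  have hT : ∀ a, a ∈ torsion N ↔ a ∈ T := fun a => mem_torsion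
  have hsub : ∀ {ρ σ : M2R}, imageLattice N ρ = imageLattice N σ →
      T.map (actHom ρ) ≤ T.map (actHom σ) := by
    rintro ρ σ h _ ⟨a, ha, rfl⟩
    have ha' := (hT a).2 ha
    obtain ⟨y, rfl⟩ := exists_divClass_eq ha'
    obtain ⟨x, hx⟩ := exists_divClass_eq (act_mem_torsion ρ ha')
    have hxm : x ∈ imageLattice N σ := h ▸ mem_imageLattice.2 ⟨y, hx.symm⟩
    obtain ⟨z, hz⟩ := mem_imageLattice.1 hxm
    exact ⟨divClass N z, (hT _).1 (divClass_mem_torsion z), hz.trans hx⟩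
  have hmap : T.map (actHom σ) = T.map (actHom ρ) := le_antisymm (hsub h.symm) (hsub h)
  have ht : ∀ c, c ∈ (torsion N).image (actHom ρ) ↔ c ∈ T.map (actHom ρ) := by
    intro c
    simp [AddSubgroup.mem_map, hT]
  have h1 := card_range_mul_sum _ T hT _ _ ht (actHom ρ) rfl g
  have h2 := card_range_mul_sum _ T hT _ _ ht (actHom σ) hmap g
  have h0 : (((torsion N).image (actHom ρ)).card : ℂ) ≠ 0 := by
    rw [Nat.cast_ne_zero, ← Nat.pos_iff_ne_zero, Finset.card_pos]
    exact ⟨0, (ht 0).2 (zero_mem _)⟩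
  exact mul_left_cancel₀ h0 (h1.trans h2.symm)

lemma sum_torsion_eq_sum_range {N : ℕ} [NeZero N] (g : (Fin 2 → QmodZ) → ℂ) :
    ∑ a ∈ torsion N, g a =
      ∑ i ∈ Finset.range N, ∑ j ∈ Finset.range N, g (divClass N ![(i : ℤ), (j : ℤ)]) := by
  rw [← Finset.sum_product']
  symm
  refine Finset.sum_bij (fun x _ => divClass N ![(x.1 : ℤ), (x.2 : ℤ)])
    (fun x _ => divClass_mem_torsion _) ?_ ?_ (fun _ _ => rfl)
  · rintro ⟨i, j⟩ hx ⟨i', j'⟩ hy h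
    rw [Finset.mem_product, Finset.mem_range, Finset.mem_range] at hx hy
    rw [← sub_eq_zero, ← map_sub, divClass_eq_zero, mem_NZ2] at h
    obtain ⟨y, hy'⟩ := h
    have h0 := congrFun hy' 0
    have h1 := congrFun hy' 1
    simp only [Pi.sub_apply, Pi.smul_apply, Matrix.cons_val_zero, Matrix.cons_val_one,
      smul_eq_mul] at h0 h1
    have key : ∀ {a b : ℕ} {c : ℤ}, a < N → b < N → (a : ℤ) - b = N * c → a = b := by
      intro a b c ha hb h
      have := Int.eq_zero_of_abs_lt_dvd ⟨c, h⟩ (by rw [abs_lt]; constructor <;> omega)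
      omega
    exact Prod.ext (key hx.1 hy.1 h0) (key hx.2 hy.2 h1)
  · intro a ha
    obtain ⟨x, rfl⟩ := exists_divClass_eq ha
    have hN : (0 : ℤ) < N := by exact_mod_cast Nat.pos_of_ne_zero (NeZero.ne N)
    refine ⟨((x 0 % N).toNat, (x 1 % N).toNat), ?_, ?_⟩
    · have h0 := Int.emod_lt_of_pos (x 0) hN
      have h1 := Int.emod_lt_of_pos (x 1) hN
      simp only [Finset.mem_product, Finset.mem_range]
      omega
    · rw [← sub_eq_zero, ← map_sub, divClass_eq_zero, mem_NZ2]
      refine ⟨![-(x 0 / N), -(x 1 / N)], ?_⟩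
      have h0 := Int.emod_nonneg (x 0) hN.ne'
      have h1 := Int.emod_nonneg (x 1) hN.ne'
      ext i
      fin_cases i
      · simp [max_eq_left h0]
        linarith [Int.emod_add_mul_ediv (x 0) N]
      · simp [max_eq_left h1]
        linarith [Int.emod_add_mul_ediv (x 1) N]

/-! ### The functions `X_a` -/

lemma X_eq_X_act (a : Fin 2 → QmodZ) (ρ : M2R) (τ : UpperHalfPlane) :
    X a ρ τ = X (act ρ a) 1 τ := by
  have h : phi 1 τ (act ρ a) = phi ρ τ a := by rw [phi, phi, act_one]
  rw [X, X, h]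

lemma phi_one_coe (v : Fin 2 → ℚ) (τ : UpperHalfPlane) :
    phi 1 τ (fun i => (v i : QmodZ)) = Submodule.Quotient.mk ((v 0 : ℂ) + ((-v 1 : ℝ) : ℂ) * τ) := by
  rw [phi, act_one]
  have h : ∀ (w : ℂ) (hw : w ∈ Lam τ) (x : ℚ),
      mulPeriod τ w hw (x : QmodZ) = Submodule.Quotient.mk ((x : ℂ) * w) := fun _ _ _ => rfl
  refine (congrArg₂ (· - ·) (h 1 _ _) (h τ _ _)).trans ?_
  rw [← Submodule.Quotient.mk_sub]
  congr 1
  push_cast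
  ring

/-- No case distinction is needed: with `1 / 0 = 0` every term of the series for `℘(0)` vanishes,
matching the convention for `X` where `φ(a) = 0`. -/
lemma X_one_coe (v : Fin 2 → ℚ) (τ : UpperHalfPlane) :
    X (fun i => (v i : QmodZ)) 1 τ = ((Real.pi : ℂ) ^ 2)⁻¹ *
      (periods τ).weierstrassP (((v 0 : ℝ) : ℂ) + ((-v 1 : ℝ) : ℂ) * τ) := by
  rw [X, phi_one_coe]
  have hwp : ∀ z : ℂ, wp τ (Submodule.Quotient.mk z) = (periods τ).weierstrassP z := fun _ => rfl
  split_ifs with h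
  · rw [Submodule.Quotient.mk_eq_zero] at h
    have := (periods τ).weierstrassP_add_coe 0 ⟨_, h⟩
    rw [zero_add] at this
    simp only [Complex.ofReal_ratCast]
    rw [this]
    simp [PeriodPair.weierstrassP]
  · rw [hwp]
    simp

lemma exists_coe_eq (b : Fin 2 → QmodZ) : ∃ v : Fin 2 → ℚ, b = fun i => (v i : QmodZ) := by
  choose v hv using fun i => QuotientAddGroup.mk_surjective (b i)
  exact ⟨v, funext fun i => (hv i).symm⟩

lemma mdifferentiable_X (a : Fin 2 → QmodZ) (ρ : M2R) :
    MDifferentiable (modelWithCornersSelf ℂ ℂ) (modelWithCornersSelf ℂ ℂ) (X a ρ) := by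
  obtain ⟨v, hv⟩ := exists_coe_eq (act ρ a)
  rw [UpperHalfPlane.mdifferentiable_iff]
  intro z hz
  refine DifferentiableAt.differentiableWithinAt ?_
  have hE : DifferentiableAt ℂ (EisensteinSeries.E2 ∘ UpperHalfPlane.ofComplex) z :=
    (UpperHalfPlane.mdifferentiable_iff.1 E2_mdifferentiable).differentiableAt
      (UpperHalfPlane.isOpen_upperHalfPlaneSet.mem_nhds hz)
  have h := ((differentiableAt_tsum_rowSum (-v 1 : ℝ) (v 0 : ℝ) hz).sub
    (hE.const_mul (2 * riemannZeta 2))).const_mul ((Real.pi : ℂ) ^ 2)⁻¹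
  refine h.congr_of_eventuallyEq ?_
  filter_upwards [UpperHalfPlane.isOpen_upperHalfPlaneSet.mem_nhds hz] with w hw
  have hz2 : riemannZeta 2 ≠ 0 := by
    rw [riemannZeta_two]
    simp [Real.pi_ne_zero]
  simp only [Function.comp_apply, X_eq_X_act a, hv, X_one_coe,
    UpperHalfPlane.ofComplex_apply_of_im_pos hw, Pi.sub_apply, EisensteinSeries.E2, Pi.smul_apply,
    smul_eq_mul]
  rw [← mul_assoc, mul_one_div_cancel (mul_ne_zero two_ne_zero hz2), one_mul]
  exact congrArg _ (weierstrassP_eq_tsum_rowSum _ _ ⟨w, hw⟩)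

lemma isBoundedAtImInfty_X (a : Fin 2 → QmodZ) (ρ : M2R) :
    UpperHalfPlane.IsBoundedAtImInfty (X a ρ) := by
  obtain ⟨v, hv⟩ := exists_coe_eq (act ρ a)
  obtain ⟨C, A, hC⟩ := UpperHalfPlane.isBoundedAtImInfty_iff.1 EisensteinSeries.isBoundedAtImInfty_E2
  rw [UpperHalfPlane.isBoundedAtImInfty_iff]
  -- The row sums are bounded for `Im τ ≥ 1`, and `E2` is bounded by `C` for `Im τ ≥ A`.
  refine ⟨‖((Real.pi : ℂ) ^ 2)⁻¹‖ * ((∑' m, rowBound (-v 1 : ℝ) (v 0 : ℝ) 1 m) +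
    ‖2 * riemannZeta 2‖ * C), max A 1, fun τ hτ => ?_⟩
  have hz2 : riemannZeta 2 ≠ 0 := by
    rw [riemannZeta_two]
    simp [Real.pi_ne_zero]
  have hG : EisensteinSeries.G2 τ = 2 * riemannZeta 2 * EisensteinSeries.E2 τ := by
    rw [EisensteinSeries.E2, Pi.smul_apply, smul_eq_mul, ← mul_assoc,
      mul_one_div_cancel (mul_ne_zero two_ne_zero hz2), one_mul]
  rw [X_eq_X_act, hv, X_one_coe, weierstrassP_eq_tsum_rowSum, norm_mul, hG]
  refine mul_le_mul_of_nonneg_left ((norm_sub_le _ _).trans (add_le_add ?_ ?_)) (norm_nonneg _)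
  · exact norm_tsum_rowSum_le _ _ ((le_max_right _ _).trans hτ)
  · rw [norm_mul]
    exact mul_le_mul_of_nonneg_left (hC τ ((le_max_left _ _).trans hτ)) (norm_nonneg _)

/-! ### Transformation under the full modular group -/

lemma mem_lattice_smul_iff (γ : SL(2, ℤ)) (τ : UpperHalfPlane) (z : ℂ) :
    z ∈ (periods (γ • τ)).lattice ↔
      (((γ 1 0 : ℤ) : ℂ) * τ + ((γ 1 1 : ℤ) : ℂ)) * z ∈ (periods τ).lattice := by
  have hj : ((γ 1 0 : ℤ) : ℂ) * τ + ((γ 1 1 : ℤ) : ℂ) ≠ 0 := by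
    simpa [UpperHalfPlane.denom] using UpperHalfPlane.denom_ne_zero γ τ
  have hdet : ((γ 0 0 : ℤ) : ℂ) * γ 1 1 - γ 0 1 * γ 1 0 = 1 := by
    have := γ.det_coe
    rw [Matrix.det_fin_two] at this
    exact_mod_cast this
  have hγ : ((γ • τ : UpperHalfPlane) : ℂ) = (((γ 0 0 : ℤ) : ℂ) * τ + ((γ 0 1 : ℤ) : ℂ)) /
      (((γ 1 0 : ℤ) : ℂ) * τ + ((γ 1 1 : ℤ) : ℂ)) := by
    rw [UpperHalfPlane.specialLinearGroup_apply]
    simp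
  rw [PeriodPair.mem_lattice, PeriodPair.mem_lattice]
  simp only [periods, hγ]
  constructor
  · rintro ⟨m, n, rfl⟩
    refine ⟨m * γ 1 1 + n * γ 0 1, m * γ 1 0 + n * γ 0 0, ?_⟩
    push_cast
    field_simp
    ring
  · rintro ⟨m, n, h⟩
    refine ⟨γ 0 0 * m - γ 0 1 * n, -γ 1 0 * m + γ 1 1 * n, ?_⟩
    refine mul_left_cancel₀ hj (Eq.trans ?_ h)
    push_cast
    field_simp
    linear_combination (m + n * (τ : ℂ)) * hdet

lemma weierstrassP_smul (γ : SL(2, ℤ)) (τ : UpperHalfPlane) (z : ℂ) :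
    (periods (γ • τ)).weierstrassP z =
      (((γ 1 0 : ℤ) : ℂ) * τ + ((γ 1 1 : ℤ) : ℂ)) ^ 2 *
        (periods τ).weierstrassP ((((γ 1 0 : ℤ) : ℂ) * τ + ((γ 1 1 : ℤ) : ℂ)) * z) := by
  have hj : ((γ 1 0 : ℤ) : ℂ) * τ + ((γ 1 1 : ℤ) : ℂ) ≠ 0 := by
    simpa [UpperHalfPlane.denom] using UpperHalfPlane.denom_ne_zero γ τ
  let e : (periods (γ • τ)).lattice ≃ (periods τ).lattice :=
    (Equiv.mulLeft₀ _ hj).subtypeEquiv (mem_lattice_smul_iff γ τ)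
  have he : ∀ l, ((e l : (periods τ).lattice) : ℂ) =
      (((γ 1 0 : ℤ) : ℂ) * τ + ((γ 1 1 : ℤ) : ℂ)) * l := fun _ => rfl
  rw [PeriodPair.weierstrassP, PeriodPair.weierstrassP, ← e.tsum_eq, ← tsum_mul_left]
  refine tsum_congr fun l => ?_
  rw [he, ← mul_sub, mul_pow, mul_pow, mul_sub, mul_one_div, mul_one_div, ← div_div, ← div_div,
    div_self (pow_ne_zero 2 hj)]

/-- Multiplication by `cτ + d` takes `v₀ - v₁ γτ` to `w₀ - w₁ τ` with `w = γ⁻¹ v`; the factor is the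
homogeneity of ℘. -/
lemma X_smul (a : Fin 2 → QmodZ) (ρ : M2R) (γ : SL(2, ℤ)) (τ : UpperHalfPlane) :
    X a ρ (γ • τ) = (((γ 1 0 : ℤ) : ℂ) * τ + ((γ 1 1 : ℤ) : ℂ)) ^ 2 *
      X a (toM2R ((γ⁻¹ : SL(2, ℤ)) : Matrix (Fin 2) (Fin 2) ℤ) * ρ) τ := by
  have hj : ((γ 1 0 : ℤ) : ℂ) * τ + ((γ 1 1 : ℤ) : ℂ) ≠ 0 := by
    simpa [UpperHalfPlane.denom] using UpperHalfPlane.denom_ne_zero γ τ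
  have hγ : ((γ • τ : UpperHalfPlane) : ℂ) = (((γ 0 0 : ℤ) : ℂ) * τ + ((γ 0 1 : ℤ) : ℂ)) /
      (((γ 1 0 : ℤ) : ℂ) * τ + ((γ 1 1 : ℤ) : ℂ)) := by
    rw [UpperHalfPlane.specialLinearGroup_apply]
    simp
  rw [X_eq_X_act a ρ, X_eq_X_act a, act_mul]
  obtain ⟨v, hv⟩ := exists_coe_eq (act ρ a)
  rw [hv, act_toM2R_coe, X_one_coe, X_one_coe, weierstrassP_smul, hγ, mul_left_comm]
  congr 3
  simp [Matrix.mulVec, dotProduct, Fin.sum_univ_two, Matrix.SpecialLinearGroup.coe_inv,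
    Matrix.adjugate_fin_two]
  field_simp
  ring

/-! ### The forms `ω` -/

/-- The power sum `∑_{N a = 0} X_a(ρ, τ)^k`. -/
def powerSum (N : ℕ) [NeZero N] (k : ℕ) (ρ : M2R) (τ : UpperHalfPlane) : ℂ :=
  ∑ a ∈ torsion N, X a ρ τ ^ k

lemma powerSum_congr {N : ℕ} [NeZero N] (k : ℕ) {ρ σ : M2R}
    (h : imageLattice N ρ = imageLattice N σ) : powerSum N k ρ = powerSum N k σ := by
  ext τ
  simp only [powerSum, X_eq_X_act _ ρ, X_eq_X_act _ σ]
  exact sum_torsion_act_congr h fun b => X b 1 τ ^ k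

lemma powerSum_smul (N : ℕ) [NeZero N] (k : ℕ) (ρ : M2R) (γ : SL(2, ℤ)) (τ : UpperHalfPlane) :
    powerSum N k ρ (γ • τ) = (((γ 1 0 : ℤ) : ℂ) * τ + ((γ 1 1 : ℤ) : ℂ)) ^ (2 * k) *
      powerSum N k (toM2R ((γ⁻¹ : SL(2, ℤ)) : Matrix (Fin 2) (Fin 2) ℤ) * ρ) τ := by
  simp only [powerSum, X_smul, mul_pow, ← pow_mul, Finset.mul_sum]

open scoped ModularForm in
lemma powerSum_slash (N : ℕ) [NeZero N] (k : ℕ) (ρ : M2R) (γ : SL(2, ℤ)) :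
    powerSum N k ρ ∣[(2 * (k : ℤ))] γ =
      powerSum N k (toM2R ((γ⁻¹ : SL(2, ℤ)) : Matrix (Fin 2) (Fin 2) ℤ) * ρ) := by
  ext τ
  have hj : ((γ 1 0 : ℤ) : ℂ) * τ + ((γ 1 1 : ℤ) : ℂ) ≠ 0 := by
    simpa [UpperHalfPlane.denom] using UpperHalfPlane.denom_ne_zero γ τ
  have hd : UpperHalfPlane.denom γ τ = ((γ 1 0 : ℤ) : ℂ) * τ + ((γ 1 1 : ℤ) : ℂ) := by
    simp [UpperHalfPlane.denom]
  rw [ModularForm.SL_slash_apply, powerSum_smul, hd, mul_comm, ← mul_assoc, zpow_neg,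
    show (2 * (k : ℤ)) = ((2 * k : ℕ) : ℤ) by push_cast; rfl, zpow_natCast,
    inv_mul_cancel₀ (pow_ne_zero _ hj), one_mul]

lemma smulLattice_of_mem_Gamma {N : ℕ} {γ : SL(2, ℤ)} (hγ : γ ∈ CongruenceSubgroup.Gamma N)
    {L : SubZ2} (hL : NZ2 N ≤ L) : smulLattice γ L = L := by
  have key : ∀ γ ∈ CongruenceSubgroup.Gamma N, ∀ x ∈ L,
      (γ : Matrix (Fin 2) (Fin 2) ℤ).mulVec x ∈ L := by
    intro γ hγ x hx
    have hdvd : ∀ i j, (N : ℤ) ∣ γ i j - (1 : Matrix (Fin 2) (Fin 2) ℤ) i j := by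
      intro i j
      rw [← ZMod.intCast_eq_intCast_iff_dvd_sub, eq_comm]
      have := congrFun (congrFun (congrArg Subtype.val (CongruenceSubgroup.Gamma_mem'.1 hγ)) i) j
      simpa [Matrix.one_apply, apply_ite] using this
    choose c hc using hdvd
    have h2 : (γ : Matrix (Fin 2) (Fin 2) ℤ) = 1 + (N : ℤ) • Matrix.of c := by
      ext i j
      simp [← hc]
    rw [h2, Matrix.add_mulVec, Matrix.one_mulVec, Matrix.smul_mulVec]
    exact L.add_mem hx (hL (mem_NZ2.2 ⟨_, rfl⟩))
  apply le_antisymm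
  · rintro _ ⟨x, hx, rfl⟩
    exact key γ hγ x hx
  · intro x hx
    refine ⟨((γ⁻¹ : SL(2, ℤ)) : Matrix (Fin 2) (Fin 2) ℤ).mulVec x, key _ (inv_mem hγ) x hx, ?_⟩
    rw [Matrix.mulVecLin_apply, Matrix.mulVec_mulVec, ← Matrix.SpecialLinearGroup.coe_mul,
      mul_inv_cancel, Matrix.SpecialLinearGroup.coe_one, Matrix.one_mulVec]

lemma mdifferentiable_powerSum (N : ℕ) [NeZero N] (k : ℕ) (ρ : M2R) :
    MDifferentiable (modelWithCornersSelf ℂ ℂ) (modelWithCornersSelf ℂ ℂ) (powerSum N k ρ) := by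
  rw [UpperHalfPlane.mdifferentiable_iff]
  exact DifferentiableOn.fun_sum fun a _ =>
    (UpperHalfPlane.mdifferentiable_iff.1 (mdifferentiable_X a ρ)).pow k

lemma isBoundedAtImInfty_powerSum (N : ℕ) [NeZero N] (k : ℕ) (ρ : M2R) :
    UpperHalfPlane.IsBoundedAtImInfty (powerSum N k ρ) := by
  choose C A hC using fun a => UpperHalfPlane.isBoundedAtImInfty_iff.1 (isBoundedAtImInfty_X a ρ)
  rw [UpperHalfPlane.isBoundedAtImInfty_iff]
  refine ⟨∑ a ∈ torsion N, C a ^ k, (torsion N).sup' ⟨0, mem_torsion.2 (smul_zero _)⟩ A,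
    fun τ hτ => (norm_sum_le _ _).trans (Finset.sum_le_sum fun a ha => ?_)⟩
  rw [norm_pow]
  exact pow_le_pow_left₀ (norm_nonneg _) (hC a τ ((Finset.le_sup' A ha).trans hτ)) k

/-- The power sum as a modular form of level `N` and weight `2k`. -/
def powerSumForm (N : ℕ) [NeZero N] (k : ℕ) (ρ : M2R) : MF N k where
  toFun := powerSum N k ρ
  slash_action_eq' := by
    rintro _ ⟨γ, hγ, rfl⟩
    refine (powerSum_slash N k ρ γ).trans (powerSum_congr k ?_)
    rw [imageLattice_toM2R_mul,
      smulLattice_of_mem_Gamma (inv_mem hγ) (mem_S.1 (imageLattice_mem_S N ρ))]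
  holo' := mdifferentiable_powerSum N k ρ
  bdd_at_cusps' hc := by
    rw [Subgroup.IsArithmetic.isCusp_iff_isCusp_SL2Z] at hc
    rw [OnePoint.isBoundedAt_iff_forall_SL2Z hc]
    -- Slashing by `γ` only replaces `ρ` by `γ⁻¹ρ`, so boundedness at `i∞` for all `ρ` covers every
    -- cusp.
    intro γ _
    rw [powerSum_slash]
    exact isBoundedAtImInfty_powerSum N k _

lemma powerSumForm_apply (N : ℕ) [NeZero N] (k : ℕ) (ρ : M2R) (τ : UpperHalfPlane) :
    powerSumForm N k ρ τ = powerSum N k ρ τ := rfl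

/-! ### The cocycle `μ` -/

/-- The image of `γ ∈ GL₂⁺(ℚ)` in `GL₂(ℝ)`. -/
abbrev toGLReal : GL(2, ℚ)⁺ →* GL (Fin 2) ℝ :=
  (Matrix.GeneralLinearGroup.map (algebraMap ℚ ℝ)).comp (Subgroup.subtype _)

lemma det_toGLReal_pos (γ : GL(2, ℚ)⁺) : 0 < (toGLReal γ).det.val := by
  have h : (0 : ℚ) < γ.1.det.val := γ.2
  have : (toGLReal γ).det.val = ((γ.1.det.val : ℚ) : ℝ) := by
    simpa using ((algebraMap ℚ ℝ).map_det γ.1.1).symm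
  rw [this]
  exact_mod_cast h

-- The slash operator of weight 12 carries `det ^ 11` instead of `det ^ 6`, whence the exponent
-- `-5`.
open scoped ModularForm in
lemma slashDelta_eq_slash (γ : GL(2, ℚ)⁺) (τ : UpperHalfPlane) :
    slashDelta γ τ = (((toGLReal γ).det.val : ℝ) : ℂ) ^ (-5 : ℤ) *
      (ModularForm.discriminant ∣[(12 : ℤ)] toGLReal γ) τ := by
  have hd := det_toGLReal_pos γ
  have hd' : (((toGLReal γ).det.val : ℝ) : ℂ) ≠ 0 := by exact_mod_cast hd.ne'
  have h6 : (((toGLReal γ).det.val : ℝ) : ℂ) ^ 6 =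
      (((toGLReal γ).det.val : ℝ) : ℂ) ^ (-5 : ℤ) * (((toGLReal γ).det.val : ℝ) : ℂ) ^ 11 := by
    rw [← zpow_natCast, ← zpow_natCast, ← zpow_add₀ hd']
    norm_num
  have hdef : slashDelta γ τ = (((toGLReal γ).det.val : ℝ) : ℂ) ^ 6 *
      ModularForm.discriminant (toGLReal γ • τ) *
      UpperHalfPlane.denom (toGLReal γ) τ ^ (-12 : ℤ) := rfl
  rw [hdef, ModularForm.slash_def, UpperHalfPlane.σ, if_pos hd, abs_of_pos hd, h6]
  simp only [ContinuousAlgEquiv.refl_apply]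
  norm_num
  ring

open scoped ModularForm in
lemma slashDelta_mul_of_eq_mapGL (γ γ' : GL(2, ℚ)⁺) (g : SL(2, ℤ))
    (h : toGLReal γ' = Matrix.SpecialLinearGroup.mapGL ℝ g * toGLReal γ) :
    slashDelta γ' = slashDelta γ := by
  ext τ
  have hg : ModularForm.discriminant ∣[(12 : ℤ)] (Matrix.SpecialLinearGroup.mapGL ℝ g) =
      ModularForm.discriminant :=
    CuspForm.discriminant.slash_action_eq' _ ⟨g, rfl⟩
  have hdet : (toGLReal γ').det = (toGLReal γ).det := by
    rw [h, map_mul]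
    ext
    simp
  rw [slashDelta_eq_slash, slashDelta_eq_slash, hdet, h, SlashAction.slash_mul]
  congr 2
  exact congrArg (fun f : UpperHalfPlane → ℂ => (f ∣[(12 : ℤ)] toGLReal γ) τ) hg

lemma exists_eq_mul_of_latticeOf_eq {m m' : M2ZPos} (h : latticeOf m.1 = latticeOf m'.1) :
    ∃ g : SL(2, ℤ), m'.1 = m.1 * (g : Matrix (Fin 2) (Fin 2) ℤ) := by
  have key : ∀ m m' : M2ZPos, latticeOf m.1 = latticeOf m'.1 →
      ∃ g : Matrix (Fin 2) (Fin 2) ℤ, m'.1 = m.1 * g := by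
    intro m m' h
    have : ∀ j, ∃ y, m.1.mulVec y = m'.1.mulVec (Pi.single j 1) := fun j =>
      mem_latticeOf.1 (h ▸ mem_latticeOf.2 ⟨_, rfl⟩)
    choose y hy using this
    refine ⟨Matrix.of fun i j => y j i, ?_⟩
    ext i j
    have := congrFun (hy j) i
    rw [Matrix.mulVec_single_one] at this
    exact this.symm
  obtain ⟨g, hg⟩ := key m m' h
  obtain ⟨g', hg'⟩ := key m' m h.symm
  have h1 : m'.1.det = m.1.det * g.det := by rw [hg, Matrix.det_mul]
  have h2 : m.1.det = m'.1.det * g'.det := by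
    rw [← Matrix.det_mul, ← hg']
  have hm := m.2
  have hm' := m'.2
  have hgpos : 0 < g.det := by
    rw [h1] at hm'
    exact (pos_iff_pos_of_mul_pos hm').1 hm
  have h3 : g.det * g'.det = 1 := by
    rw [h1, mul_assoc] at h2
    exact mul_left_cancel₀ hm.ne' (by rw [mul_one]; exact h2.symm)
  have h4 : g.det = 1 := by
    rcases Int.eq_one_or_neg_one_of_mul_eq_one h3 with h | h <;> omega
  exact ⟨⟨g, h4⟩, hg⟩

lemma coe_toGLReal_toGLPos (m : M2ZPos) :
    (toGLReal (toGLPos m)).val = m.1.map (Int.cast : ℤ → ℝ) := by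
  ext i j
  simp [toGLPos]

/-- If `m' = m g` then `m'⁻¹ = g⁻¹ m⁻¹`, and Δ is invariant under the left factor `g⁻¹` in `SL₂(ℤ)`.
-/
lemma mu_toGLPos_inv_eq {m m' : M2ZPos} (h : latticeOf m.1 = latticeOf m'.1) :
    mu (toGLPos m')⁻¹ = mu (toGLPos m)⁻¹ := by
  obtain ⟨g, hg⟩ := exists_eq_mul_of_latticeOf_eq h
  have h1 : toGLReal (toGLPos m') = toGLReal (toGLPos m) * Matrix.SpecialLinearGroup.mapGL ℝ g := by
    apply Units.ext
    rw [Units.val_mul, coe_toGLReal_toGLPos, coe_toGLReal_toGLPos, hg]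
    ext i j
    simp [Matrix.mul_apply]
  have h2 : slashDelta (toGLPos m')⁻¹ = slashDelta (toGLPos m)⁻¹ :=
    slashDelta_mul_of_eq_mapGL _ _ g⁻¹ (by rw [map_inv, map_inv, map_inv, h1, mul_inv_rev])
  ext τ
  rw [mu, mu, h2]

lemma mu_toGLPos_inv (m : M2ZPos) : mu (toGLPos m)⁻¹ = muL (latticeOf m.1) := by
  have hex : ∃ m' : M2ZPos, latticeOf m'.1 = latticeOf m.1 := ⟨m, rfl⟩
  rw [muL, dif_pos hex]
  exact mu_toGLPos_inv_eq hex.choose_spec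

lemma slashDelta_triangular {p s : ℕ} {q : ℤ} {m : M2ZPos}
    (hm : m.1 = !![(p : ℤ), q; 0, (s : ℤ)]) (hp : 0 < p) (hs : 0 < s) :
    ∃ C : ℂ, C ≠ 0 ∧ ∀ τ τ' : UpperHalfPlane, (τ' : ℂ) = (s * τ - q) / p →
      slashDelta (toGLPos m)⁻¹ τ = C * ModularForm.discriminant τ' := by
  have hpR : (p : ℝ) ≠ 0 := by positivity
  have hsR : (s : ℝ) ≠ 0 := by positivity
  have hpC : (p : ℂ) ≠ 0 := by exact_mod_cast hp.ne'
  have hsC : (s : ℂ) ≠ 0 := by exact_mod_cast hs.ne'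
  have hval : (toGLReal (toGLPos m)).val = !![(p : ℝ), q; 0, (s : ℝ)] := by
    rw [coe_toGLReal_toGLPos, hm]
    ext i j
    fin_cases i <;> fin_cases j <;> simp
  have hinv : ((toGLReal (toGLPos m))⁻¹).val = !![1 / (p : ℝ), -q / (p * s); 0, 1 / (s : ℝ)] := by
    have : !![1 / (p : ℝ), -q / (p * s); 0, 1 / (s : ℝ)] * (toGLReal (toGLPos m)).val = 1 := by
      rw [hval]
      ext i j
      fin_cases i <;> fin_cases j <;> simp [Matrix.mul_apply, Fin.sum_univ_two, hpR, hsR]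
      field_simp
      ring
    exact (Units.eq_inv_of_mul_eq_one_right this).symm
  have hdet := det_toGLReal_pos (toGLPos m)⁻¹
  refine ⟨(((toGLReal (toGLPos m)⁻¹).det.val : ℝ) : ℂ) ^ 6 * (1 / (s : ℂ)) ^ (-12 : ℤ),
    mul_ne_zero (pow_ne_zero _ (by exact_mod_cast hdet.ne'))
      (zpow_ne_zero _ (one_div_ne_zero hsC)), fun τ τ' hτ => ?_⟩
  have hsmul : toGLReal (toGLPos m)⁻¹ • τ = τ' := by
    ext
    rw [UpperHalfPlane.coe_smul_of_det_pos hdet, hτ, UpperHalfPlane.num, UpperHalfPlane.denom,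
      map_inv, hinv]
    simp
    field_simp
    ring
  have hdef : slashDelta (toGLPos m)⁻¹ τ = (((toGLReal (toGLPos m)⁻¹).det.val : ℝ) : ℂ) ^ 6 *
      ModularForm.discriminant (toGLReal (toGLPos m)⁻¹ • τ) *
      UpperHalfPlane.denom (toGLReal (toGLPos m)⁻¹) τ ^ (-12 : ℤ) := rfl
  have hden : UpperHalfPlane.denom (toGLReal (toGLPos m)⁻¹) τ = 1 / (s : ℂ) := by
    rw [UpperHalfPlane.denom, map_inv, hinv]
    simp
  rw [hdef, hsmul, hden]
  ring

lemma logDeriv_const_mul_pow_div_pow {f g : ℂ → ℂ} {z C : ℂ} (hC : C ≠ 0) (n : ℕ)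
    (hf : DifferentiableAt ℂ f z) (hg : DifferentiableAt ℂ g z) (hf0 : f z ≠ 0) (hg0 : g z ≠ 0) :
    logDeriv (fun w => C * f w ^ n / g w ^ n) z = n * logDeriv f z - n * logDeriv g z := by
  rw [logDeriv_div (f := fun w => C * f w ^ n) (g := fun w => g w ^ n) z
    (mul_ne_zero hC (pow_ne_zero _ hf0)) (pow_ne_zero _ hg0) ((hf.fun_pow n).const_mul C)
    (hg.fun_pow n), logDeriv_const_mul z C hC, logDeriv_fun_pow hf, logDeriv_fun_pow hg]

lemma im_triangular_pos {p s : ℕ} (q : ℤ) (hp : 0 < p) (hs : 0 < s) {z : ℂ} (hz : 0 < z.im) :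
    0 < ((s * z - q) / p : ℂ).im := by
  rw [← Complex.ofReal_natCast p, Complex.div_ofReal_im]
  simp
  positivity

/-- As `Δ = η²⁴` and `η'/η = (πi/12) E2`, the prefactor `1/(6πi)` leaves `(1/3)((s/p) E2(τ') -
E2(τ))`, and `G2 = (π²/3) E2`. -/
lemma mu_triangular {p s : ℕ} {q : ℤ} {m : M2ZPos}
    (hm : m.1 = !![(p : ℤ), q; 0, (s : ℤ)]) (hp : 0 < p) (hs : 0 < s) (τ τ' : UpperHalfPlane)
    (hτ : (τ' : ℂ) = (s * τ - q) / p) :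
    mu (toGLPos m)⁻¹ τ = ((Real.pi : ℂ) ^ 2)⁻¹ *
      (s / p * EisensteinSeries.G2 τ' - EisensteinSeries.G2 τ) := by
  obtain ⟨C, hC, h⟩ := slashDelta_triangular hm hp hs
  have hev : (fun z : ℂ => slashDelta (toGLPos m)⁻¹ (UpperHalfPlane.ofComplex z) /
      ModularForm.discriminant (UpperHalfPlane.ofComplex z)) =ᶠ[nhds (τ : ℂ)]
      fun z => (C * ModularForm.eta ((s * z - q) / p) ^ 24) / ModularForm.eta z ^ 24 := by
    filter_upwards [UpperHalfPlane.isOpen_upperHalfPlaneSet.mem_nhds τ.im_pos] with z hz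
    rw [UpperHalfPlane.ofComplex_apply_of_im_pos hz,
      h ⟨z, hz⟩ ⟨_, im_triangular_pos q hp hs hz⟩ rfl]
    rfl
  have hη : ∀ {z : ℂ}, 0 < z.im → DifferentiableAt ℂ ModularForm.eta z := fun hz =>
    ModularForm.differentiableAt_eta_of_mem_upperHalfPlaneSet hz
  have hη0 : ∀ {z : ℂ}, 0 < z.im → ModularForm.eta z ≠ 0 := fun hz => ModularForm.eta_ne_zero hz
  have him := im_triangular_pos q hp hs τ.im_pos
  have hlin : DifferentiableAt ℂ (fun z : ℂ => (s * z - q) / p) τ := by fun_prop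
  have hcomp : DifferentiableAt ℂ (fun z : ℂ => ModularForm.eta ((s * z - q) / p)) τ :=
    DifferentiableAt.comp (g := ModularForm.eta) (f := fun z : ℂ => (s * z - q) / p) (τ : ℂ) (hη him) hlin
  have hlog : logDeriv (fun z : ℂ => ModularForm.eta ((s * z - q) / p)) τ =
      s / p * logDeriv ModularForm.eta τ' := by
    refine (logDeriv_comp (f := ModularForm.eta) (g := fun z : ℂ => (s * z - q) / p)
      (hη him) hlin).trans ?_
    rw [hτ, mul_comm]
    congr 1
    simp [deriv_div_const, deriv_sub_const]
  have hpi : (Real.pi : ℂ) ≠ 0 := by exact_mod_cast Real.pi_ne_zero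
  rw [mu, logDeriv_apply, hev.deriv_eq, hev.eq_of_nhds, ← logDeriv_apply,
    logDeriv_const_mul_pow_div_pow hC 24 hcomp (hη τ.im_pos) (hη0 him) (hη0 τ.im_pos), hlog,
    ModularForm.logDeriv_eta_eq_E2, ModularForm.logDeriv_eta_eq_E2]
  simp only [EisensteinSeries.E2, Pi.smul_apply, smul_eq_mul, riemannZeta_two]
  field_simp
  ring

/-- Both sides depend only on the lattice, so `m` may be taken triangular. -/
lemma powerSum_one_eq {N : ℕ} [NeZero N] {m : M2ZPos} (hm : NZ2 N ≤ latticeOf m.1)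
    (τ : UpperHalfPlane) :
    powerSum N 1 (toM2R m.1) τ = N ^ 2 * muL (latticeOf m.1) τ := by
  obtain ⟨p, s, A, B, q, x, hA, hB, hx, hL⟩ := exists_triangular hm
  have hp : 0 < p := Nat.pos_of_ne_zero (by rintro rfl; exact NeZero.ne N (by simpa using hA))
  have hs : 0 < s := Nat.pos_of_ne_zero (by rintro rfl; exact NeZero.ne N (by simpa using hB))
  set m₀ : Matrix (Fin 2) (Fin 2) ℤ := !![(p : ℤ), q; 0, (s : ℤ)] with hm₀
  have hdet : 0 < m₀.det := by
    rw [hm₀, Matrix.det_fin_two_of]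
    simp only [mul_zero, sub_zero]
    positivity
  have himg : imageLattice N (toM2R m.1) = imageLattice N (toM2R m₀) := by
    rw [imageLattice_toM2R hm, imageLattice_toM2R (hL ▸ hm), hL]
  let τ' : UpperHalfPlane := ⟨_, im_triangular_pos q hp hs τ.im_pos⟩
  have hmu := mu_triangular (m := ⟨m₀, hdet⟩) hm₀ hp hs τ τ' rfl
  have hsum := sum_weierstrassP_triangular hA hB hx τ τ' rfl
  rw [powerSum_congr 1 himg, hL, ← mu_toGLPos_inv ⟨m₀, hdet⟩, hmu, mul_left_comm, ← hsum, powerSum]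
  simp only [pow_one, X_eq_X_act _ (toM2R m₀), Finset.mul_sum]
  rw [sum_torsion_eq_sum_range (N := N) (fun a => X (act (toM2R m₀) a) 1 τ)]
  refine Finset.sum_congr rfl fun i _ => Finset.sum_congr rfl fun j _ => ?_
  rw [act_toM2R_divClass, divClass_apply, X_one_coe fun k => ((m₀.mulVec ![(i : ℤ), (j : ℤ)] k : ℤ) / N : ℚ)]
  simp only [hm₀, Matrix.mulVec, dotProduct, Fin.sum_univ_two]
  congr 2
  simp
  ring

/-- The form `ω_{N, L, k}`, the power sum at any `ρ` whose image lattice is `L`. -/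
def omega (N : ℕ) [NeZero N] (L : SubZ2) (k : ℕ) : MF N k :=
  open Classical in
  if h : L ∈ S N then powerSumForm N k (toM2R (exists_latticeOf_eq h).choose.1) else 0

lemma omega_imageLattice (N : ℕ) [NeZero N] (ρ : M2R) (k : ℕ) (τ : UpperHalfPlane) :
    omega N (imageLattice N ρ) k τ = powerSum N k ρ τ := by
  have h := imageLattice_mem_S N ρ
  have hm := (exists_latticeOf_eq h).choose_spec
  rw [omega, dif_pos h, powerSumForm_apply,
    powerSum_congr k ((imageLattice_toM2R (hm.symm ▸ mem_S.1 h)).trans hm)]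

lemma exists_imageLattice_eq {N : ℕ} [NeZero N] {L : SubZ2} (hL : L ∈ S N) :
    ∃ m : M2ZPos, latticeOf m.1 = L ∧ imageLattice N (toM2R m.1) = L := by
  obtain ⟨m, rfl⟩ := exists_latticeOf_eq hL
  exact ⟨m, rfl, imageLattice_toM2R (mem_S.1 hL)⟩

lemma omega_one {N : ℕ} [NeZero N] {L : SubZ2} (hL : L ∈ S N) (τ : UpperHalfPlane) :
    omega N L 1 τ = (N : ℂ) ^ 2 * muL L τ := by
  obtain ⟨m, rfl, h⟩ := exists_imageLattice_eq hL
  rw [← powerSum_one_eq (mem_S.1 hL), ← omega_imageLattice, h]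

end DivisionRelations

end

theorem mainTheorem9 (N : ℕ) [NeZero N] :
    ∃ ω : DivisionRelations.SubZ2 → (k : ℕ) → DivisionRelations.MF N k,
      -- the division relations
      (∀ (k : ℕ) (ρ : DivisionRelations.M2R) (τ : UpperHalfPlane),
        ∑ a ∈ DivisionRelations.torsion N, DivisionRelations.X a ρ τ ^ k =
          ∑ L ∈ DivisionRelations.S N, DivisionRelations.piNL N L ρ * ω L k τ) ∧
      -- they determine the forms, even among arbitrary functions on the half-plane
      (∀ (k : ℕ) (ω' : DivisionRelations.SubZ2 → UpperHalfPlane → ℂ),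
        (∀ (ρ : DivisionRelations.M2R) (τ : UpperHalfPlane),
          ∑ a ∈ DivisionRelations.torsion N, DivisionRelations.X a ρ τ ^ k =
            ∑ L ∈ DivisionRelations.S N, DivisionRelations.piNL N L ρ * ω' L τ) →
        ∀ L ∈ DivisionRelations.S N, ∀ τ : UpperHalfPlane, ω' L τ = ω L k τ) ∧
      -- the behaviour under the full modular group
      (∀ L ∈ DivisionRelations.S N, ∀ (k : ℕ) (γ : Matrix.SpecialLinearGroup (Fin 2) ℤ)
        (τ : UpperHalfPlane),
        ω L k (γ • τ) = (((γ 1 0 : ℤ) : ℂ) * τ + ((γ 1 1 : ℤ) : ℂ)) ^ (2 * k) *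
          ω (DivisionRelations.smulLattice γ⁻¹ L) k τ) ∧
      -- the case `k = 1`: the cocycle depends only on the lattice, and gives the forms
      (∀ L ∈ DivisionRelations.S N, ∃ m : DivisionRelations.M2ZPos,
        DivisionRelations.latticeOf m.1 = L) ∧
      (∀ m : DivisionRelations.M2ZPos,
        DivisionRelations.mu (DivisionRelations.toGLPos m)⁻¹ =
          DivisionRelations.muL (DivisionRelations.latticeOf m.1)) ∧
      (∀ L ∈ DivisionRelations.S N, ∀ τ : UpperHalfPlane,
        ω L 1 τ = (N : ℂ) ^ 2 * DivisionRelations.muL L τ) ∧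
      (∀ (ρ : DivisionRelations.M2R) (τ : UpperHalfPlane),
        ∑ a ∈ DivisionRelations.torsion N, DivisionRelations.X a ρ τ =
          (N : ℂ) ^ 2 * ∑ L ∈ DivisionRelations.S N,
            DivisionRelations.piNL N L ρ * DivisionRelations.muL L τ) := by
  refine ⟨DivisionRelations.omega N, ?_, ?_, ?_, fun L hL => DivisionRelations.exists_latticeOf_eq hL,
    DivisionRelations.mu_toGLPos_inv, fun L hL τ => DivisionRelations.omega_one hL τ, ?_⟩
  · intro k ρ τ
    rw [DivisionRelations.sum_piNL_mul ρ (fun L => DivisionRelations.omega N L k τ),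
      DivisionRelations.omega_imageLattice]
    rfl
  · intro k ω' hω' L hL τ
    -- At `ρ = m` only the term of `L` survives, so the relation there reads off `ω' L`.
    obtain ⟨m, -, h⟩ := DivisionRelations.exists_imageLattice_eq hL
    have := hω' (DivisionRelations.toM2R m.1) τ
    rw [DivisionRelations.sum_piNL_mul _ (fun L => ω' L τ), h] at this
    rw [← this, ← h, DivisionRelations.omega_imageLattice]
    rfl
  · intro L hL k γ τ
    obtain ⟨m, -, rfl⟩ := DivisionRelations.exists_imageLattice_eq hL
    rw [← DivisionRelations.imageLattice_toM2R_mul, DivisionRelations.omega_imageLattice,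
      DivisionRelations.omega_imageLattice, DivisionRelations.powerSum_smul]
  · intro ρ τ
    have hS := DivisionRelations.imageLattice_mem_S N ρ
    rw [DivisionRelations.sum_piNL_mul ρ (fun L => DivisionRelations.muL L τ),
      ← DivisionRelations.omega_one hS, DivisionRelations.omega_imageLattice,
      DivisionRelations.powerSum]
    simp only [pow_one]
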